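/- All graphs are finite, simple and undirected. Two distinct vertices $u,v$ of a graph are \emph{false twins} if they have the same open neighbourhood, $N(u)=N(v)$. A \emph{biclique} of a graph $G$ is a set $B$ of vertices that is maximal under inclusion among the vertex sets inducing a complete bipartite subgraph of $G$ with both sides non-empty. That is, $B = U\cup W$ with $U,W$ non-empty, disjoint and independent, every vertex of $U$ is adjacent to every vertex of $W$, and no set properly containing $B$ has such a decomposition. \textbf{Theorem.} Let $G$ be a connected graph with no false twins. If $G$ has at least $13$ vertices, then $G$ has at least $7$ bicliques. -/

import Mathlib

namespace SimpleGraph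

/-- The subgraph of `G` induced by the vertex set `B` is a complete bipartite graph with two
non-empty sides: `B` splits into non-empty independent sets `U` and `W` with all edges between
them. -/
def InducesCompleteBipartite {V : Type*} (G : SimpleGraph V) (B : Set V) : Prop :=
  ∃ U W : Set V, U.Nonempty ∧ W.Nonempty ∧ Disjoint U W ∧ U ∪ W = B ∧
    G.IsIndepSet U ∧ G.IsIndepSet W ∧ G.IsCompleteBetween U W

/-- A biclique, represented by its vertex set: a maximal induced complete bipartite subgraph. -/
def IsBiclique {V : Type*} (G : SimpleGraph V) (B : Set V) : Prop :=
  Maximal G.InducesCompleteBipartite B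

/-- Two vertices are false twins when they are distinct and have the same open neighbourhood. -/
def FalseTwins {V : Type*} (G : SimpleGraph V) (u v : V) : Prop :=
  u ≠ v ∧ G.neighborSet u = G.neighborSet v

/-- A graph is false-twin-free when no two of its vertices are false twins. -/
def FalseTwinFree {V : Type*} (G : SimpleGraph V) : Prop :=
  ∀ u v : V, ¬ G.FalseTwins u v

end SimpleGraph

/-!
The proof shows that a connected graph `G` without false twins and with at most six bicliques has
at most twelve vertices. Bicliques are counted from below by `card_le_ncard_isBiclique`: complete
bipartite vertex sets no two of which have a complete bipartite union lie in distinct bicliques.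

If `G` has no triangle, a vertex `v` gives rise to the biclique with sides `N(v)` and the common
neighbourhood of `N(v)`. As a biclique has two sides and there are no false twins, at most two
vertices give rise to the same biclique, so there are at most twelve vertices
(`card_le_two_mul_ncard_isBiclique`).

If `G` has a triangle, it is excluded by a finite search for induced subgraphs of `G`. Let `H` be an
induced subgraph and call the set of neighbours in `H` of a vertex of `G` its type. A vertex joins a
biclique `A` of `H` on one side if it is adjacent to all of the other side and to none of its own;
this can be read off from its type. Suppose that any two adjacent vertices of `G` join opposite
sides of some biclique of `H`, and that any two vertices joining opposite sides are adjacent. Then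
types determine adjacency, so distinct vertices have distinct types (`eq_of_adj_iff_adj`), and `G`
has at most as many vertices as there are possible types. If the supposition fails, the failure is
witnessed by `H` and at most two further vertices, and the subgraph they induce has more bicliques
than `H` (`card_lt_of_path`, `card_lt_of_adj`, `card_lt_of_not_adj`); connectedness guarantees that
no vertex has an empty type. So, starting from the triangle, which has three bicliques, repeated
failure leads to at least seven bicliques after at most four steps, and whenever the supposition
holds there turn out to be at most twelve types.

A `Pattern` is such an `H`, encoded by natural numbers whose binary digits represent sets of
vertices. Patterns are ruled out one after the other: one with at least seven bicliques directly;
one with six because then the supposition cannot fail and there are at most twelve types; one with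
fewer because there are at most twelve types and each extension by one or two vertices in which the
supposition fails contains a pattern that was ruled out before. Earlier patterns also exclude some
types. `not_realizes_of_check` proves that the corresponding computable test is sound, and the test is run
on the list `derivedPatterns`, followed by the triangle.
-/

/-! ### Complete bipartite vertex sets and the triangle-free case -/

namespace SimpleGraph
open Set

variable {V : Type*} {G : SimpleGraph V}

/-- The sets `U` and `W` are the two sides of an induced complete bipartite subgraph. -/
structure Sides (G : SimpleGraph V) (U W : Set V) : Prop where
  left_nonempty : U.Nonempty
  right_nonempty : W.Nonempty
  left_indep : ∀ u ∈ U, ∀ v ∈ U, ¬ G.Adj u v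
  right_indep : ∀ u ∈ W, ∀ v ∈ W, ¬ G.Adj u v
  complete : ∀ u ∈ U, ∀ w ∈ W, G.Adj u w

namespace Sides

variable {U W : Set V}

theorem symm (h : G.Sides U W) : G.Sides W U :=
  ⟨h.2, h.1, h.4, h.3, fun u hu w hw => (h.5 w hw u hu).symm⟩

theorem inducesCompleteBipartite (h : G.Sides U W) : G.InducesCompleteBipartite (U ∪ W) := by
  refine ⟨U, W, h.1, h.2, ?_, rfl, fun u hu v hv _ => h.3 u hu v hv,
    fun u hu v hv _ => h.4 u hu v hv, fun u hu w hw => h.5 u hu w hw⟩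
  exact Set.disjoint_left.2 fun x hx hx' => G.irrefl (h.5 x hx x hx')

theorem mem_right (h : G.Sides U W) {x y : V} (hx : x ∈ U) (hy : y ∈ U ∪ W) (hxy : G.Adj x y) :
    y ∈ W := hy.resolve_left fun hy => h.3 x hx y hy hxy

theorem mem_left_of_not_adj (h : G.Sides U W) {x y : V} (hx : x ∈ U) (hy : y ∈ U ∪ W)
    (hxy : ¬ G.Adj x y) : y ∈ U := hy.resolve_right fun hy => hxy (h.5 x hx y hy)

end Sides

theorem inducesCompleteBipartite_iff {B : Set V} :
    G.InducesCompleteBipartite B ↔ ∃ U W, G.Sides U W ∧ U ∪ W = B := by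
  constructor
  · rintro ⟨U, W, hU, hW, -, rfl, hU', hW', hc⟩
    refine ⟨U, W, ⟨hU, hW, fun u hu v hv h => hU' hu hv h.ne h,
      fun u hu v hv h => hW' hu hv h.ne h, fun u hu w hw => hc hu hw⟩, rfl⟩
  · rintro ⟨U, W, h, rfl⟩
    exact h.inducesCompleteBipartite

namespace InducesCompleteBipartite

variable {B C : Set V}

theorem exists_adj (h : G.InducesCompleteBipartite B) : ∃ x ∈ B, ∃ y ∈ B, G.Adj x y := by
  obtain ⟨U, W, hs, rfl⟩ := inducesCompleteBipartite_iff.1 h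
  obtain ⟨u, hu⟩ := hs.1
  obtain ⟨w, hw⟩ := hs.2
  exact ⟨u, .inl hu, w, .inr hw, hs.5 u hu w hw⟩

theorem mono (h : G.InducesCompleteBipartite C) (hBC : B ⊆ C) {x y : V} (hx : x ∈ B) (hy : y ∈ B)
    (hxy : G.Adj x y) : G.InducesCompleteBipartite B := by
  obtain ⟨U, W, hs, rfl⟩ := inducesCompleteBipartite_iff.1 h
  clear h
  wlog hxU : x ∈ U generalizing U W
  · exact this W U hs.symm (by rwa [Set.union_comm]) ((hBC hx).resolve_left hxU)
  refine inducesCompleteBipartite_iff.2 ⟨B ∩ U, B ∩ W, ⟨⟨x, hx, hxU⟩,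
    ⟨y, hy, hs.mem_right hxU (hBC hy) hxy⟩, fun u hu v hv => hs.3 u hu.2 v hv.2,
    fun u hu v hv => hs.4 u hu.2 v hv.2, fun u hu v hv => hs.5 u hu.2 v hv.2⟩, ?_⟩
  rw [← Set.inter_union_distrib_left, Set.inter_eq_left.2 hBC]

end InducesCompleteBipartite

theorem InducesCompleteBipartite.exists_isBiclique [Finite V] {B : Set V}
    (h : G.InducesCompleteBipartite B) : ∃ C, G.IsBiclique C ∧ B ⊆ C := by
  obtain ⟨C, hBC, hC⟩ := (Set.toFinite {B | G.InducesCompleteBipartite B}).exists_le_maximal h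
  exact ⟨C, hC, hBC⟩

/-- Complete bipartite vertex sets no two of which have a complete bipartite union lie in pairwise
distinct bicliques. -/
theorem card_le_ncard_isBiclique [Finite V] {ι : Type*} [Fintype ι] (B : ι → Set V)
    (hB : ∀ i, G.InducesCompleteBipartite (B i))
    (hne : ∀ i j, i ≠ j → ¬ G.InducesCompleteBipartite (B i ∪ B j)) :
    Fintype.card ι ≤ {C : Set V | G.IsBiclique C}.ncard := by
  choose C hC hBC using fun i => (hB i).exists_isBiclique
  have hinj : Function.Injective C := by
    intro i j hij
    by_contra hne'
    obtain ⟨x, hx, y, hy, hxy⟩ := (hB i).exists_adj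
    exact hne i j hne' ((hC i).1.mono (Set.union_subset (hBC i) (hij ▸ hBC j)) (.inl hx) (.inl hy)
      hxy)
  rw [← Nat.card_eq_fintype_card, ← Nat.card_range_of_injective hinj]
  exact Set.ncard_le_ncard (by rintro _ ⟨i, rfl⟩; exact hC i) (Set.toFinite _)

/-- If neighbourhoods are independent, a vertex `v` is recorded by the biclique with sides `N(v)`
and the common neighbourhood of `N(v)`; twin-freeness makes this record at most two-to-one, as a
biclique has two sides. -/
theorem card_le_two_mul_ncard_isBiclique [Fintype V] (htwin : G.FalseTwinFree)
    (hnbr : ∀ v, ∃ w, G.Adj v w)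
    (htri : ∀ u v w, G.Adj u v → G.Adj u w → ¬ G.Adj v w) :
    Fintype.card V ≤ 2 * {C : Set V | G.IsBiclique C}.ncard := by
  classical
  let U : V → Set V := fun v => {x | G.neighborSet v ⊆ G.neighborSet x}
  have hself : ∀ v, v ∈ U v := fun v => Set.mem_ofPred.2 subset_rfl
  have hS : ∀ v, G.Sides (U v) (G.neighborSet v) := by
    intro v
    obtain ⟨w, hw⟩ := hnbr v
    exact ⟨⟨v, hself v⟩, ⟨w, hw⟩,
      fun x hx y hy => htri w x y (hx hw).symm (hy hw).symm,
      fun x hx y hy => htri v x y hx hy, fun x hx y hy => hx hy⟩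
  have hBic : ∀ v, G.IsBiclique (U v ∪ G.neighborSet v) := by
    refine fun v => ⟨(hS v).inducesCompleteBipartite, fun D hD hle => ?_⟩
    obtain ⟨X, Y, h, rfl⟩ := inducesCompleteBipartite_iff.1 hD
    have hv : v ∈ X ∪ Y := hle (.inl (hself v))
    wlog hvX : v ∈ X generalizing X Y
    · exact Set.union_comm Y X ▸ this Y X h.symm (by rwa [Set.union_comm Y X])
        (by rwa [Set.union_comm Y X]) (by rwa [Set.union_comm Y X]) (hv.resolve_left hvX)
    have hN : G.neighborSet v ⊆ Y := fun y hy => h.mem_right hvX (hle (.inr hy)) hy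
    refine Set.union_subset (fun x hx => .inl fun y hy => h.5 x hx y (hN hy))
      fun y hy => .inr (h.5 v hvX y hy)
  have hside : ∀ v X Y, G.Sides X Y → X ∪ Y = U v ∪ G.neighborSet v → v ∈ X →
      G.neighborSet v = Y := by
    intro v X Y h heq hv
    ext y
    exact ⟨fun hy => h.mem_right hv (heq ▸ .inr hy) hy, fun hy => h.5 v hv y hy⟩
  let s : Finset (Set V) := (Set.toFinite {C : Set V | G.IsBiclique C}).toFinset
  have hs : {C : Set V | G.IsBiclique C}.ncard = s.card :=
    Set.ncard_eq_toFinset_card _ (Set.toFinite _)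
  rw [hs, ← Finset.card_univ]
  refine Finset.card_le_mul_card_image_of_maps_to (f := fun v => U v ∪ G.neighborSet v)
    (fun v _ => by simpa [s] using hBic v) 2 fun C hC => ?_
  have hC' : G.IsBiclique C := by simpa [s] using hC
  obtain ⟨X, Y, h, rfl⟩ := inducesCompleteBipartite_iff.1 hC'.1
  have hinj : ∀ v w, X ∪ Y = U v ∪ G.neighborSet v → X ∪ Y = U w ∪ G.neighborSet w →
      (v ∈ X ↔ w ∈ X) → v = w := by
    intro v w hv hw hvw
    by_contra hne
    refine htwin v w ⟨hne, ?_⟩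
    by_cases hvX : v ∈ X
    · rw [hside v X Y h hv hvX, hside w X Y h hw (hvw.1 hvX)]
    · have hvY : v ∈ Y := (hv.symm.subset (.inl (hself v))).resolve_left hvX
      have hwY : w ∈ Y :=
        (hw.symm.subset (.inl (hself w))).resolve_left (mt hvw.2 hvX)
      rw [hside v Y X h.symm (by rwa [Set.union_comm]) hvY,
        hside w Y X h.symm (by rwa [Set.union_comm]) hwY]
  have := Finset.card_le_card_of_injOn (t := (Finset.univ : Finset Prop)) (fun v => v ∈ X)
    (s := {a ∈ (Finset.univ : Finset V) | U a ∪ G.neighborSet a = X ∪ Y})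
    (fun _ _ => Finset.mem_coe.2 (Finset.mem_univ _)) (by
      intro v hv w hw hvw
      simp only [Finset.coe_filter, Finset.mem_univ, true_and, Set.mem_ofPred_eq] at hv hw
      exact hinj v w hv.symm hw.symm (iff_of_eq hvw))
  simpa using this

end SimpleGraph

/-! ### Bicliques of an induced subgraph -/

namespace SimpleGraph
open Set

variable {V : Type*} {G : SimpleGraph V}

/-- The vertex `v` relates to a complete bipartite set with sides `X` and `Y` as the vertices of
`X` do. -/
def Joins (G : SimpleGraph V) (X Y : Set V) (v : V) : Prop :=
  (∀ x ∈ X, ¬ G.Adj v x) ∧ ∀ y ∈ Y, G.Adj v y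

/-- `X` and `Y` are the sides of a biclique of the subgraph induced by `R`. -/
structure BicliqueIn (G : SimpleGraph V) (R X Y : Set V) : Prop where
  sides : G.Sides X Y
  left_subset : X ⊆ R
  right_subset : Y ⊆ R
  mem_left : ∀ v ∈ R, G.Joins X Y v → v ∈ X
  mem_right : ∀ v ∈ R, G.Joins Y X v → v ∈ Y

theorem Joins.congr {X Y : Set V} {u v : V} {R : Set V} (hX : X ⊆ R) (hY : Y ⊆ R)
    (huv : ∀ r ∈ R, G.Adj u r ↔ G.Adj v r) (h : G.Joins X Y u) : G.Joins X Y v :=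
  ⟨fun x hx hv => h.1 x hx ((huv x (hX hx)).2 hv), fun y hy => (huv y (hY hy)).1 (h.2 y hy)⟩

namespace Sides

variable {X Y U W : Set V}

theorem joins_left (h : G.Sides X Y) {v : V} (hv : v ∈ X) : G.Joins X Y v :=
  ⟨h.3 v hv, h.5 v hv⟩

theorem mono_joins (h : G.Sides U W) (hX : X ⊆ U) (hY : Y ⊆ W) {v : V} (hv : v ∈ U) :
    G.Joins X Y v :=
  ⟨fun x hx => h.3 v hv x (hX hx), fun y hy => h.5 v hv y (hY hy)⟩

theorem insert_left (h : G.Sides X Y) {v : V} (hv : G.Joins X Y v) :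
    G.Sides (insert v X) Y := by
  refine ⟨⟨v, .inl rfl⟩, h.2, ?_, h.4, ?_⟩
  · rintro a (rfl | ha) b (rfl | hb)
    · exact G.irrefl
    · exact hv.1 b hb
    · exact fun hab => hv.1 a ha hab.symm
    · exact h.3 a ha b hb
  · rintro a (rfl | ha) b hb
    · exact hv.2 b hb
    · exact h.5 a ha b hb

/-- The bipartition of a complete bipartite set restricts to that of any complete bipartite
subset. -/
theorem exists_extension (h : G.Sides X Y) {D : Set V} (hD : G.InducesCompleteBipartite D)
    (hsub : X ∪ Y ⊆ D) : ∃ U W, G.Sides U W ∧ U ∪ W = D ∧ X ⊆ U ∧ Y ⊆ W := by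
  obtain ⟨U, W, hs, rfl⟩ := inducesCompleteBipartite_iff.1 hD
  clear hD
  obtain ⟨x, hx⟩ := h.1
  wlog hxU : x ∈ U generalizing U W
  · obtain ⟨U', W', h1, h2, h3⟩ := this W U hs.symm (by rwa [Set.union_comm W U])
      ((hsub (.inl hx)).resolve_left hxU)
    exact ⟨U', W', h1, h2.trans (Set.union_comm W U), h3⟩
  refine ⟨U, W, hs, rfl, fun x' hx' => ?_, fun y hy => ?_⟩
  · exact hs.mem_left_of_not_adj hxU (hsub (.inl hx')) (h.3 x hx x' hx')
  · exact hs.mem_right hxU (hsub (.inr hy)) (h.5 x hx y hy)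

end Sides

namespace BicliqueIn

variable {R X Y : Set V}

theorem symm (h : G.BicliqueIn R X Y) : G.BicliqueIn R Y X :=
  ⟨h.1.symm, h.3, h.2, h.5, h.4⟩

theorem subset_of_union {X' Y' : Set V} (h : G.BicliqueIn R X Y) (h' : G.BicliqueIn R X' Y')
    (hu : G.InducesCompleteBipartite (X ∪ Y ∪ (X' ∪ Y'))) : X' ∪ Y' ⊆ X ∪ Y := by
  obtain ⟨U, W, hs, heq, hX, hY⟩ := h.1.exists_extension hu Set.subset_union_left
  intro v hv
  have hvR : v ∈ R := Set.union_subset h'.2 h'.3 hv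
  rcases heq.symm.subset (.inr hv) with hvU | hvW
  · exact .inl (h.4 v hvR (hs.mono_joins hX hY hvU))
  · exact .inr (h.5 v hvR (hs.symm.mono_joins hY hX hvW))

theorem eq_of_union {X' Y' : Set V} (h : G.BicliqueIn R X Y) (h' : G.BicliqueIn R X' Y')
    (hu : G.InducesCompleteBipartite (X ∪ Y ∪ (X' ∪ Y'))) : X ∪ Y = X' ∪ Y' :=
  (h'.subset_of_union h (by rwa [Set.union_comm])).antisymm (h.subset_of_union h' hu)

end BicliqueIn

section Family

variable [Finite V] {ι : Type*} [Fintype ι] {R : Set V} {X Y : ι → Set V}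

theorem card_le_of_bicliqueIn (hA : ∀ i, G.BicliqueIn R (X i) (Y i))
    (hd : ∀ i j, X i ∪ Y i = X j ∪ Y j → i = j) :
    Fintype.card ι ≤ {C : Set V | G.IsBiclique C}.ncard :=
  card_le_ncard_isBiclique (fun i => X i ∪ Y i) (fun i => (hA i).1.inducesCompleteBipartite)
    fun i j hij hu => hij (hd i j ((hA i).eq_of_union (hA j) hu))

/-- A complete bipartite set that fits into none of the bicliques of an induced subgraph forces a
further biclique. -/
theorem card_lt_of_not_union (hA : ∀ i, G.BicliqueIn R (X i) (Y i))
    (hd : ∀ i j, X i ∪ Y i = X j ∪ Y j → i = j) {Q : Set V}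
    (hQ : G.InducesCompleteBipartite Q)
    (hQA : ∀ i, ¬ G.InducesCompleteBipartite (X i ∪ Y i ∪ Q)) :
    Fintype.card ι < {C : Set V | G.IsBiclique C}.ncard := by
  rw [← Nat.succ_le_iff, Nat.succ_eq_add_one, ← Fintype.card_option]
  refine card_le_ncard_isBiclique (fun o => o.elim Q fun i => X i ∪ Y i) ?_ ?_
  · rintro (_ | i)
    · exact hQ
    · exact (hA i).1.inducesCompleteBipartite
  · rintro (_ | i) (_ | j) hij hu
    · exact hij rfl
    · exact hQA j (Set.union_comm Q _ ▸ hu)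
    · exact hQA i hu
    · exact hij (congrArg some (hd i j ((hA i).eq_of_union (hA j) hu)))

theorem card_lt_of_adj (hA : ∀ i, G.BicliqueIn R (X i) (Y i))
    (hd : ∀ i j, X i ∪ Y i = X j ∪ Y j → i = j) {u v : V} (huv : G.Adj u v)
    (hn : ∀ i, ¬ (G.Joins (X i) (Y i) u ∧ G.Joins (Y i) (X i) v) ∧
      ¬ (G.Joins (Y i) (X i) u ∧ G.Joins (X i) (Y i) v)) :
    Fintype.card ι < {C : Set V | G.IsBiclique C}.ncard := by
  have hQ : G.Sides {u} {v} := ⟨⟨u, rfl⟩, ⟨v, rfl⟩, by rintro _ rfl _ rfl; exact G.irrefl,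
    by rintro _ rfl _ rfl; exact G.irrefl, by rintro _ rfl _ rfl; exact huv⟩
  refine card_lt_of_not_union hA hd hQ.inducesCompleteBipartite fun i hi => ?_
  obtain ⟨U, W, hs, heq, hX, hY⟩ := (hA i).1.exists_extension hi Set.subset_union_left
  have hu : u ∈ U ∪ W := heq.symm.subset (.inr (.inl rfl))
  have hv : v ∈ U ∪ W := heq.symm.subset (.inr (.inr rfl))
  rcases hu with hu | hu
  · exact (hn i).1 ⟨hs.mono_joins hX hY hu, hs.symm.mono_joins hY hX (hs.mem_right hu hv huv)⟩
  · exact (hn i).2 ⟨hs.symm.mono_joins hY hX hu,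
      hs.mono_joins hX hY (hs.symm.mem_right hu (by rwa [Set.union_comm]) huv)⟩

/-- The set `{z, h, h'}` is an edge or an induced path; if it fits into no biclique of the
subgraph induced by `R`, it forces a further one. -/
theorem card_lt_of_path (hA : ∀ i, G.BicliqueIn R (X i) (Y i))
    (hd : ∀ i j, X i ∪ Y i = X j ∪ Y j → i = j) {z h h' : V} (hR : h ∈ R) (hR' : h' ∈ R)
    (hzh : G.Adj z h) (hx : ¬ (G.Adj h h' ↔ G.Adj z h'))
    (hn : ∀ i, ¬ (G.Joins (X i) (Y i) z ∧ h ∈ Y i ∧ h' ∈ X i ∪ Y i) ∧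
      ¬ (G.Joins (Y i) (X i) z ∧ h ∈ X i ∧ h' ∈ X i ∪ Y i)) :
    Fintype.card ι < {C : Set V | G.IsBiclique C}.ncard := by
  have hQ : G.InducesCompleteBipartite ({z, h, h'} : Set V) := by
    by_cases h1 : G.Adj h h'
    · have h2 : ¬ G.Adj z h' := fun h2 => hx (iff_of_true h1 h2)
      refine inducesCompleteBipartite_iff.2 ⟨{h}, {z, h'}, ⟨⟨h, rfl⟩, ⟨z, .inl rfl⟩, ?_, ?_, ?_⟩,
        ?_⟩
      · rintro _ rfl _ rfl; exact G.irrefl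
      · rintro _ (rfl | rfl) _ (rfl | rfl)
        exacts [G.irrefl, h2, fun h3 => h2 h3.symm, G.irrefl]
      · rintro _ rfl _ (rfl | rfl)
        exacts [hzh.symm, h1]
      · exact Set.insert_comm h z {h'}
    · have h2 : G.Adj z h' := by_contra fun h2 => hx (iff_of_false h1 h2)
      refine inducesCompleteBipartite_iff.2 ⟨{z}, {h, h'}, ⟨⟨z, rfl⟩, ⟨h, .inl rfl⟩, ?_, ?_, ?_⟩,
        rfl⟩
      · rintro _ rfl _ rfl; exact G.irrefl
      · rintro _ (rfl | rfl) _ (rfl | rfl)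
        exacts [G.irrefl, h1, fun h3 => h1 h3.symm, G.irrefl]
      · rintro _ rfl _ (rfl | rfl)
        exacts [hzh, h2]
  refine card_lt_of_not_union hA hd hQ fun i hi => ?_
  obtain ⟨U, W, hs, heq, hX, hY⟩ := (hA i).1.exists_extension hi Set.subset_union_left
  have hmem : ∀ q ∈ ({z, h, h'} : Set V), q ∈ U ∪ W := fun q hq => heq.symm.subset (.inr hq)
  have hz := hmem z (.inl rfl)
  have hh := hmem h (.inr (.inl rfl))
  have hh' : h' ∈ X i ∪ Y i := by
    rcases hmem h' (.inr (.inr rfl)) with hU | hW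
    · exact .inl ((hA i).4 _ hR' (hs.mono_joins hX hY hU))
    · exact .inr ((hA i).5 _ hR' (hs.symm.mono_joins hY hX hW))
  rcases hz with hz | hz
  · exact (hn i).1 ⟨hs.mono_joins hX hY hz,
      (hA i).5 _ hR (hs.symm.mono_joins hY hX (hs.mem_right hz hh hzh)), hh'⟩
  · exact (hn i).2 ⟨hs.symm.mono_joins hY hX hz, (hA i).4 _ hR (hs.mono_joins hX hY
      (hs.symm.mem_right hz (by rwa [Set.union_comm]) hzh)), hh'⟩

/-- Two non-adjacent vertices that join opposite sides of a biclique of an induced subgraph split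
it into two bicliques of the whole graph. -/
theorem card_lt_of_not_adj (hA : ∀ i, G.BicliqueIn R (X i) (Y i))
    (hd : ∀ i j, X i ∪ Y i = X j ∪ Y j → i = j) {u v : V} {i : ι} (hu : G.Joins (X i) (Y i) u)
    (hv : G.Joins (Y i) (X i) v) (huv : ¬ G.Adj u v) :
    Fintype.card ι < {C : Set V | G.IsBiclique C}.ncard := by
  classical
  rw [← Nat.succ_le_iff, Nat.succ_eq_add_one, ← Fintype.card_option]
  let B : Option ι → Set V := fun o => o.elim (insert v (X i ∪ Y i)) fun j =>
    if j = i then insert u (X i ∪ Y i) else X j ∪ Y j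
  have hIu : G.InducesCompleteBipartite (insert u (X i ∪ Y i)) :=
    Set.insert_union ▸ ((hA i).1.insert_left hu).inducesCompleteBipartite
  have hIv : G.InducesCompleteBipartite (insert v (X i ∪ Y i)) := by
    have := ((hA i).1.symm.insert_left hv).inducesCompleteBipartite
    rwa [Set.insert_union, Set.union_comm (Y i)] at this
  -- each set of the new family contains the biclique of the old family it comes from
  have hsub : ∀ o : Option ι, X (o.getD i) ∪ Y (o.getD i) ⊆ B o := by
    rintro (_ | j)
    · exact Set.subset_insert _ _
    · by_cases hj : j = i
      · subst hj; simp [B]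
      · simp [B, hj]
  have key : ∀ o o' : Option ι, G.InducesCompleteBipartite (B o ∪ B o') →
      o.getD i = o'.getD i := by
    intro o o' h
    obtain ⟨x, hx, y, hy, hxy⟩ := (hA (o.getD i)).1.inducesCompleteBipartite.exists_adj
    exact hd _ _ ((hA _).eq_of_union (hA _)
      (h.mono (Set.union_subset_union (hsub o) (hsub o')) (.inl hx) (.inl hy) hxy))
  have hsplit : ¬ G.InducesCompleteBipartite
      (insert u (X i ∪ Y i) ∪ insert v (X i ∪ Y i)) := by
    intro h
    obtain ⟨U, W, hs, heq, hX, hY⟩ := (hA i).1.exists_extension h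
      ((Set.subset_insert _ _).trans Set.subset_union_left)
    obtain ⟨x, hx⟩ := (hA i).1.1
    obtain ⟨y, hy⟩ := (hA i).1.2
    have hu' : u ∈ U := hs.symm.mem_right (hY hy)
      (by rw [Set.union_comm, heq]; exact .inl (.inl rfl)) (hu.2 y hy).symm
    have hv' : v ∈ W := hs.mem_right (hX hx)
      (by rw [heq]; exact .inr (.inl rfl)) (hv.2 x hx).symm
    exact huv (hs.5 u hu' v hv')
  refine card_le_ncard_isBiclique B ?_ ?_
  · rintro (_ | j)
    · exact hIv
    · by_cases hj : j = i
      · simpa [B, hj] using hIu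
      · simpa [B, hj] using (hA j).1.inducesCompleteBipartite
  · rintro (_ | j) (_ | k) hjk h
    · exact hjk rfl
    · have : i = k := key none (some k) h
      subst this
      exact hsplit (by simpa [B, Set.union_comm] using h)
    · have : j = i := key (some j) none h
      subst this
      exact hsplit (by simpa [B] using h)
    · exact hjk (congrArg some (key (some j) (some k) h))

end Family

/-- If every edge runs between opposite sides of some biclique of the subgraph induced by `R`, and
vertices joining opposite sides of such a biclique are adjacent, then the adjacency of two vertices
is determined by their neighbours in `R`; without false twins, vertices are then determined by
their neighbours in `R`. -/
theorem eq_of_adj_iff_adj {ι : Type*} {R : Set V} {X Y : ι → Set V}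
    (htwin : G.FalseTwinFree) (hA : ∀ i, G.BicliqueIn R (X i) (Y i))
    (hedge : ∀ u v, G.Adj u v → ∃ i, (G.Joins (X i) (Y i) u ∧ G.Joins (Y i) (X i) v) ∨
      (G.Joins (Y i) (X i) u ∧ G.Joins (X i) (Y i) v))
    (hadj : ∀ i u v, G.Joins (X i) (Y i) u → G.Joins (Y i) (X i) v → G.Adj u v) {u v : V}
    (huv : ∀ r ∈ R, G.Adj u r ↔ G.Adj v r) : u = v := by
  have key : ∀ u v, (∀ r ∈ R, G.Adj u r ↔ G.Adj v r) → ∀ z, G.Adj u z → G.Adj v z := by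
    intro u v huv z hz
    obtain ⟨i, ⟨h1, h2⟩ | ⟨h1, h2⟩⟩ := hedge u z hz
    · exact hadj i v z (h1.congr (hA i).2 (hA i).3 huv) h2
    · exact (hadj i z v h2 (h1.congr (hA i).3 (hA i).2 huv)).symm
  by_contra hne
  refine htwin u v ⟨hne, Set.ext fun z => ⟨key u v huv z, key v u (fun r hr => (huv r hr).symm) z⟩⟩

end SimpleGraph

/-! ### Patterns and the test for ruling them out -/

namespace SimpleGraph

/-- A finite graph on the vertices `0, 1, …`, with the data that show that no counterexample to the
theorem has it as an induced subgraph. Sets of vertices are encoded by the binary digits of a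
natural number.
* `rows` lists the neighbourhoods of the vertices;
* `bics` lists all bicliques, each as the pair of its sides;
* `types` lists the sets that can be the neighbourhood in this graph of a vertex of a
  counterexample;
* `extWitnesses` and `pairWitnesses` name, for each extension by one or by two vertices that has to
  be ruled out, a pattern inside it that has been ruled out before. They follow the order in which
  `checkExt`, from the largest mask down, and `pairExts` run through these extensions. -/
structure Pattern where
  rows : List ℕ
  bics : List (ℕ × ℕ)
  types : List ℕ
  extWitnesses : List ℕ
  pairWitnesses : List ℕ

namespace Pattern

/-- The `i`-th binary digit of `n`. This and the following functions are written with the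
arithmetic functions on `ℕ` that the kernel evaluates natively. -/
def bit (n i : ℕ) : Bool := Nat.beq (Nat.land (Nat.shiftRight n i) 1) 1

/-- Equality of Booleans. -/
def boolEq (a b : Bool) : Bool := bif a then b else !b

/-- Membership in a list of natural numbers. -/
def memB (n : ℕ) : List ℕ → Bool
  | [] => false
  | a :: l => bif Nat.beq n a then true else memB n l

/-- Absence of repetitions in a list of natural numbers. -/
def nodupB : List ℕ → Bool
  | [] => true
  | a :: l => !memB a l && nodupB l

/-- Auxiliary function for `addVertex`: the rows from the `i`-th on, with the new column `S` in
position `m`, and the new row. -/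
def addVertexAux (m S : ℕ) : ℕ → List ℕ → List ℕ
  | _, [] => [S]
  | i, r :: rs =>
    (bif bit S i then Nat.lor r (Nat.pow 2 m) else r) :: addVertexAux m S (Nat.succ i) rs

/-- The rows of the graph with one more vertex, whose neighbourhood is `S`. -/
def addVertex (g : List ℕ) (S : ℕ) : List ℕ := addVertexAux g.length S 0 g

/-- The pairs of the singleton mask and the row of each vertex; `p` is the mask of the first. -/
def numbered : ℕ → List ℕ → List (ℕ × ℕ)
  | _, [] => []
  | p, r :: rs => (p, r) :: numbered (Nat.add p p) rs

/-- The image of the set `p` under the map that sends `k - 1, k - 2, …` to the vertices with the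
listed singleton masks. -/
def image (p : ℕ) : ℕ → List ℕ → ℕ
  | _, [] => 0
  | k, w :: f =>
    bif bit p (Nat.pred k) then Nat.lor w (image p (Nat.pred k) f) else image p (Nat.pred k) f

/-- Backtracking search for an extension of a partial embedding into the graph `g` to the further
vertices with the given rows. The `k` vertices embedded so far go to the listed singleton masks,
last vertex first, with union `U`. -/
def embeds (g : List (ℕ × ℕ)) : List ℕ → ℕ → List ℕ → ℕ → Bool
  | [], _, _, _ => true
  | p :: ps, k, f, U =>
    g.any fun c => Nat.beq (Nat.land c.2 U) (image p k f) && Nat.beq (Nat.land c.1 U) 0 &&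
      embeds g ps (Nat.succ k) (c.1 :: f) (Nat.lor U c.1)

/-- The `k`-th graph of the list `L` is an induced subgraph of `g`. -/
def containsNth (L : List (List ℕ)) (k : ℕ) (g : List ℕ) : Bool :=
  match L, k with
  | [], _ => false
  | q :: _, 0 => embeds (numbered 1 g) q 0 [] 0
  | _ :: L, k + 1 => containsNth L k g

/-- The bicliques that a vertex with neighbourhood `S` joins, each with the side that it joins
first. -/
def joined (S : ℕ) : List (ℕ × ℕ) → List (ℕ × ℕ)
  | [] => []
  | A :: As =>
    bif Nat.beq (Nat.land S (Nat.lor A.1 A.2)) A.2 then A :: joined S As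
    else bif Nat.beq (Nat.land S (Nat.lor A.1 A.2)) A.1 then (A.2, A.1) :: joined S As
    else joined S As

/-- The union of those bicliques in the list that have `h` on their second side. -/
def reach (h : ℕ) : List (ℕ × ℕ) → ℕ
  | [] => 0
  | A :: As => bif bit A.2 h then Nat.lor (Nat.lor A.1 A.2) (reach h As) else reach h As

/-- Auxiliary function for `covered`: the condition for the edges to the vertices from the `i`-th
on. -/
def coveredAux (J : List (ℕ × ℕ)) (S : ℕ) : ℕ → List ℕ → Bool
  | _, [] => true
  | i, r :: rs =>
    (bif bit S i then Nat.beq (Nat.land (Nat.xor r S) (reach i J)) (Nat.xor r S) else true) &&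
      coveredAux J S (Nat.succ i) rs

/-- For a new vertex with neighbourhood `S`, each edge and each induced path on three vertices
through it lies in an old biclique that it joins. -/
def covered (rows : List ℕ) (bics : List (ℕ × ℕ)) (S : ℕ) : Bool :=
  coveredAux (joined S bics) S 0 rows

/-- New vertices with neighbourhoods `S` and `S'` join opposite sides of some biclique. -/
def opposite (bics : List (ℕ × ℕ)) (S S' : ℕ) : Bool :=
  bics.any fun A =>
    (Nat.beq (Nat.land S (Nat.lor A.1 A.2)) A.2 && Nat.beq (Nat.land S' (Nat.lor A.1 A.2)) A.1) ||
    (Nat.beq (Nat.land S (Nat.lor A.1 A.2)) A.1 && Nat.beq (Nat.land S' (Nat.lor A.1 A.2)) A.2)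

/-- Auxiliary function for `validBic`: the condition for the vertices from the `i`-th on. -/
def validBicAux (A : ℕ × ℕ) : ℕ → List ℕ → Bool
  | _, [] => true
  | i, r :: rs =>
    boolEq (Nat.beq (Nat.land r (Nat.lor A.1 A.2)) A.2) (bit A.1 i) &&
    boolEq (Nat.beq (Nat.land r (Nat.lor A.1 A.2)) A.1) (bit A.2 i) &&
    validBicAux A (Nat.succ i) rs

/-- `A` is the pair of sides of a biclique: exactly the vertices of each side relate to `A` as the
vertices of that side have to. -/
def validBic (rows : List ℕ) (A : ℕ × ℕ) : Bool :=
  !Nat.beq A.1 0 && !Nat.beq A.2 0 && Nat.blt (Nat.lor A.1 A.2) (Nat.pow 2 rows.length) &&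
    validBicAux A 0 rows

/-- The rows are those of a symmetric irreflexive relation. -/
def validRows (rows : List ℕ) : Bool :=
  (List.range rows.length).all fun i =>
    !bit (rows.getD i 0) i && Nat.blt (rows.getD i 0) (Nat.pow 2 rows.length) &&
      (List.range rows.length).all fun j => boolEq (bit (rows.getD i 0) j) (bit (rows.getD j 0) i)

/-- Each non-zero `S` below the given bound is a listed type, or the extension by a vertex with
neighbourhood `S` contains a graph from `L`, or `leaf` is set and `S` is not covered. The flag
`leaf` is for patterns with six bicliques, where a type that is not covered forces a seventh. -/
def checkExt (L : List (List ℕ)) (rows : List ℕ) (bics : List (ℕ × ℕ)) (T : List ℕ)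
    (leaf : Bool) : ℕ → List ℕ → Bool
  | 0, _ => true
  | n + 1, ks =>
    bif Nat.beq n 0 then true
    else bif leaf && !covered rows bics n then checkExt L rows bics T leaf n ks
    else bif memB n T then checkExt L rows bics T leaf n ks
    else match ks with
      | [] => false
      | k :: ks => containsNth L k (addVertex rows n) && checkExt L rows bics T leaf n ks

/-- The extension by two vertices with neighbourhoods `S` and `S'`, adjacent exactly if they do not
join opposite sides of a biclique. -/
def pairExt (rows : List ℕ) (bics : List (ℕ × ℕ)) (S S' : ℕ) : List ℕ :=
  addVertex (addVertex rows S)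
    (bif opposite bics S S' then S' else Nat.lor S' (Nat.pow 2 rows.length))

/-- The extensions `pairExt` for all unordered pairs from a list of types, and the extensions by a
vertex of each type with a pendant neighbour. -/
def pairExts (rows : List ℕ) (bics : List (ℕ × ℕ)) : List ℕ → List (List ℕ)
  | [] => []
  | S :: Ss => (S :: Ss).map (pairExt rows bics S) ++
    (addVertex (addVertex rows S) (Nat.pow 2 rows.length) :: pairExts rows bics Ss)

/-- Each graph of the list contains the graph from `L` that the list of indices names. -/
def checkPairs (L : List (List ℕ)) : List (List ℕ) → List ℕ → Bool
  | [], _ => true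
  | _ :: _, [] => false
  | g :: gs, k :: ks => containsNth L k g && checkPairs L gs ks

/-- The rows define a graph, and the listed bicliques are distinct bicliques of it. -/
def valid (P : Pattern) : Bool :=
  validRows P.rows && P.bics.all (validBic P.rows) && nodupB (P.bics.map fun A => Nat.lor A.1 A.2)

/-- The pattern cannot occur in a counterexample, provided that the graphs in `L` cannot. -/
def check (L : List (List ℕ)) (P : Pattern) : Bool :=
  valid P &&
  (Nat.ble 7 P.bics.length ||
    (Nat.ble P.types.length 12 && P.rows.all (fun r => memB r P.types) &&
      checkExt L P.rows P.bics P.types (Nat.beq P.bics.length 6) (Nat.pow 2 P.rows.length)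
        P.extWitnesses &&
      (Nat.beq P.bics.length 6 ||
        (P.types.all (covered P.rows P.bics) && Nat.ble 1 P.rows.length && !memB 0 P.types &&
          checkPairs L (pairExts P.rows P.bics P.types) P.pairWitnesses))))

/-- Each pattern of the list can be ruled out using the graphs in `L` and the preceding patterns.
Witnesses refer to the latter by counting backwards. -/
def checkList : List (List ℕ) → List Pattern → Bool
  | _, [] => true
  | L, P :: Ps => check L P && checkList (P.rows :: L) Ps

end Pattern
end SimpleGraph

/-! ### Realizations of encoded graphs -/

namespace SimpleGraph.Pattern

theorem bit_eq (n i : ℕ) : bit n i = n.testBit i := by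
  rw [Nat.testBit_eq_decide_div_mod_eq, bit]
  have : Nat.land (Nat.shiftRight n i) 1 = n / 2 ^ i % 2 := by
    show (n >>> i) &&& 1 = _
    rw [Nat.and_one_is_mod, Nat.shiftRight_eq_div_pow]
  rw [this]
  exact Bool.eq_iff_iff.2 (by simp)

theorem boolEq_iff {a b : Bool} : boolEq a b = true ↔ a = b := by
  cases a <;> cases b <;> simp [boolEq]

theorem memB_iff {n : ℕ} {l : List ℕ} : memB n l = true ↔ n ∈ l := by
  induction l with
  | nil => simp [memB]
  | cons a l ih =>
    rw [memB, List.mem_cons, ← ih]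
    by_cases h : n = a <;> simp [h, Nat.beq_eq]

theorem nodupB_iff {l : List ℕ} : nodupB l = true ↔ l.Nodup := by
  induction l with
  | nil => simp [nodupB]
  | cons a l ih => simp [nodupB, ih, ← memB_iff]

/-- `g` lists the neighbourhoods of the vertices of a finite graph. -/
structure WellFormed (g : List ℕ) : Prop where
  lt : ∀ i < g.length, g.getD i 0 < 2 ^ g.length
  irrefl : ∀ i < g.length, (g.getD i 0).testBit i = false
  symm : ∀ i < g.length, ∀ j < g.length, (g.getD i 0).testBit j = (g.getD j 0).testBit i

theorem wellFormed_of_validRows {g : List ℕ} (h : validRows g = true) : WellFormed g := by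
  have h' : ∀ i < g.length, ((g.getD i 0).testBit i = false ∧ g.getD i 0 < 2 ^ g.length) ∧
      ∀ j < g.length, (g.getD i 0).testBit j = (g.getD j 0).testBit i := by
    simpa [validRows, boolEq_iff, bit_eq, Nat.blt_eq, and_assoc] using h
  exact ⟨fun i hi => (h' i hi).1.2, fun i hi => (h' i hi).1.1, fun i hi => (h' i hi).2⟩

theorem length_addVertexAux (m S i : ℕ) (g : List ℕ) :
    (addVertexAux m S i g).length = g.length + 1 := by
  induction g generalizing i with
  | nil => rfl
  | cons r rs ih => simp [addVertexAux, ih]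

theorem getD_addVertexAux_length (m S i : ℕ) (g : List ℕ) :
    (addVertexAux m S i g).getD g.length 0 = S := by
  induction g generalizing i with
  | nil => rfl
  | cons r rs ih => simpa [addVertexAux] using ih (i + 1)

theorem testBit_getD_addVertexAux (m S i : ℕ) (g : List ℕ) {k : ℕ} (hk : k < g.length) (j : ℕ) :
    ((addVertexAux m S i g).getD k 0).testBit j =
      ((g.getD k 0).testBit j || (S.testBit (i + k) && decide (m = j))) := by
  induction g generalizing i k with
  | nil => simp at hk
  | cons r rs ih =>
    cases k with
    | zero =>
      cases h : S.testBit i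
      · simp [addVertexAux, bit_eq, h]
      · simp [addVertexAux, bit_eq, h, Nat.testBit_two_pow]
    | succ k =>
      have := ih (i + 1) (k := k) (by simpa using hk)
      simpa [addVertexAux, Nat.add_assoc, Nat.add_comm 1 k] using this

theorem length_addVertex (g : List ℕ) (S : ℕ) : (addVertex g S).length = g.length + 1 :=
  length_addVertexAux _ _ _ _

theorem getD_addVertex_length (g : List ℕ) (S : ℕ) : (addVertex g S).getD g.length 0 = S :=
  getD_addVertexAux_length _ _ _ _

theorem testBit_getD_addVertex (g : List ℕ) (S : ℕ) {k : ℕ} (hk : k < g.length) (j : ℕ) :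
    ((addVertex g S).getD k 0).testBit j =
      ((g.getD k 0).testBit j || (S.testBit k && decide (g.length = j))) := by
  simpa [addVertex] using testBit_getD_addVertexAux g.length S 0 g hk j

theorem WellFormed.addVertex {g : List ℕ} (h : WellFormed g) {S : ℕ} (hS : S < 2 ^ g.length) :
    WellFormed (addVertex g S) := by
  have hlt : ∀ {i j}, i < g.length → g.length ≤ j → (g.getD i 0).testBit j = false :=
    fun hi hj => Nat.testBit_lt_two_pow ((h.lt _ hi).trans_le (Nat.pow_le_pow_right two_pos hj))
  have hSlt : ∀ {j}, g.length ≤ j → S.testBit j = false :=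
    fun hj => Nat.testBit_lt_two_pow (hS.trans_le (Nat.pow_le_pow_right two_pos hj))
  refine ⟨fun i hi => ?_, fun i hi => ?_, fun i hi j hj => ?_⟩
  · rw [length_addVertex] at hi ⊢
    rcases Nat.lt_succ_iff_lt_or_eq.1 hi with hi | rfl
    · refine Nat.lt_pow_two_of_testBit _ fun j hj => ?_
      rw [testBit_getD_addVertex g S hi, hlt hi (by omega)]
      simp; omega
    · rw [getD_addVertex_length]
      exact hS.trans (Nat.pow_lt_pow_right one_lt_two (Nat.lt_succ_self _))
  · rw [length_addVertex] at hi
    rcases Nat.lt_succ_iff_lt_or_eq.1 hi with hi | rfl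
    · rw [testBit_getD_addVertex g S hi, h.irrefl i hi]
      simp; omega
    · rw [getD_addVertex_length, hSlt le_rfl]
  · rw [length_addVertex] at hi hj
    rcases Nat.lt_succ_iff_lt_or_eq.1 hi with hi | rfl <;>
      rcases Nat.lt_succ_iff_lt_or_eq.1 hj with hj | rfl
    · rw [testBit_getD_addVertex g S hi, testBit_getD_addVertex g S hj, h.symm i hi j hj]
      simp [hi.ne', hj.ne']
    · rw [testBit_getD_addVertex g S hi, getD_addVertex_length, hlt hi le_rfl]
      simp
    · rw [testBit_getD_addVertex g S hj, getD_addVertex_length, hlt hj le_rfl]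
      simp
    · rfl

variable {V : Type*} {G : SimpleGraph V}

/-- The map `f` embeds the graph with rows `g` as an induced subgraph of `G`. Only the digits below
the diagonal of `g` matter. -/
structure Realizes (G : SimpleGraph V) (g : List ℕ) (f : ℕ → V) : Prop where
  inj : ∀ i < g.length, ∀ j < i, f i ≠ f j
  adj : ∀ i < g.length, ∀ j < i, (G.Adj (f i) (f j) ↔ (g.getD i 0).testBit j = true)

namespace Realizes

variable {g : List ℕ} {f : ℕ → V}

theorem eq_of_eq (h : Realizes G g f) {i j : ℕ} (hi : i < g.length) (hj : j < g.length)
    (hij : f i = f j) : i = j := by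
  rcases lt_trichotomy i j with hlt | rfl | hlt
  · exact absurd hij.symm (h.inj j hj i hlt)
  · rfl
  · exact absurd hij (h.inj i hi j hlt)

theorem adj_iff (h : Realizes G g f) (hg : WellFormed g) {i j : ℕ} (hi : i < g.length)
    (hj : j < g.length) : G.Adj (f i) (f j) ↔ (g.getD i 0).testBit j = true := by
  rcases lt_trichotomy i j with hlt | rfl | hlt
  · rw [G.adj_comm, h.adj j hj i hlt, hg.symm i hi j hj]
  · rw [hg.irrefl i hi]; simp
  · exact h.adj i hi j hlt

end Realizes

/-- `S` encodes the set of those `i < m` for which `f i` is adjacent to `v`. -/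
def IsType (G : SimpleGraph V) (f : ℕ → V) (m : ℕ) (v : V) (S : ℕ) : Prop :=
  S < 2 ^ m ∧ ∀ i < m, (S.testBit i = true ↔ G.Adj v (f i))

theorem exists_isType (G : SimpleGraph V) (f : ℕ → V) (m : ℕ) (v : V) :
    ∃ S, IsType G f m v S := by
  classical
  refine ⟨Nat.ofBits fun i : Fin m => decide (G.Adj v (f i)), Nat.ofBits_lt_two_pow _,
    fun i hi => ?_⟩
  rw [Nat.testBit_ofBits_lt _ _ hi]
  simp

theorem IsType.unique {f : ℕ → V} {m S S' : ℕ} {v : V} (h : IsType G f m v S)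
    (h' : IsType G f m v S') : S = S' := by
  refine Nat.eq_of_testBit_eq fun i => ?_
  by_cases hi : i < m
  · exact Bool.eq_iff_iff.2 ((h.2 i hi).trans (h'.2 i hi).symm)
  · have := Nat.pow_le_pow_right two_pos (not_lt.1 hi)
    rw [Nat.testBit_lt_two_pow (h.1.trans_le this), Nat.testBit_lt_two_pow (h'.1.trans_le this)]

theorem Realizes.isType {g : List ℕ} {f : ℕ → V} (h : Realizes G g f) (hg : WellFormed g) {i : ℕ}
    (hi : i < g.length) : IsType G f g.length (f i) (g.getD i 0) :=
  ⟨hg.lt i hi, fun _ hj => (h.adj_iff hg hi hj).symm⟩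

theorem Realizes.addVertex {g : List ℕ} {f : ℕ → V} (h : Realizes G g f)
    {z : V} {S : ℕ} (hz : ∀ i < g.length, f i ≠ z) (hS : IsType G f g.length z S) :
    Realizes G (addVertex g S) (Function.update f g.length z) := by
  have hf : ∀ i < g.length, Function.update f g.length z i = f i :=
    fun i hi => Function.update_of_ne hi.ne _ _
  constructor <;> intro i hi j hj <;> rw [length_addVertex] at hi
  · rcases Nat.lt_succ_iff_lt_or_eq.1 hi with hi | rfl
    · rw [hf i hi, hf j (hj.trans hi)]
      exact h.inj i hi j hj
    · rw [hf j hj, Function.update_self]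
      exact (hz j hj).symm
  · rcases Nat.lt_succ_iff_lt_or_eq.1 hi with hi | rfl
    · rw [hf i hi, hf j (hj.trans hi), testBit_getD_addVertex g S hi, h.adj i hi j hj]
      simp [(hj.trans hi).ne']
    · rw [hf j hj, Function.update_self, getD_addVertex_length]
      exact (hS.2 j hj).symm

end SimpleGraph.Pattern

/-! ### Soundness of the search for embeddings -/

namespace SimpleGraph.Pattern
variable {V : Type*} {G : SimpleGraph V}

/-- The singleton masks of the values `e (k - 1), …, e 0`. -/
def singletons (e : ℕ → ℕ) : ℕ → List ℕ
  | 0 => []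
  | k + 1 => 2 ^ e k :: singletons e k

theorem testBit_image (p : ℕ) (e : ℕ → ℕ) (k v : ℕ) :
    (image p k (singletons e k)).testBit v = true ↔ ∃ j < k, p.testBit j = true ∧ e j = v := by
  induction k with
  | zero => simp [singletons, image]
  | succ k ih =>
    have hsucc : (∃ j < k + 1, p.testBit j = true ∧ e j = v) ↔
        (∃ j < k, p.testBit j = true ∧ e j = v) ∨ (p.testBit k = true ∧ e k = v) := by
      constructor
      · rintro ⟨j, hj, h⟩
        rcases Nat.lt_succ_iff_lt_or_eq.1 hj with hj | rfl
        exacts [.inl ⟨j, hj, h⟩, .inr h]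
      · rintro (⟨j, hj, h⟩ | h)
        exacts [⟨j, hj.trans (Nat.lt_succ_self k), h⟩, ⟨k, Nat.lt_succ_self k, h⟩]
    rw [hsucc, ← ih]
    cases h : p.testBit k
    · simp [singletons, image, bit_eq, h]
    · simp [singletons, image, bit_eq, h, Nat.testBit_two_pow, or_comm]

theorem mem_numbered {g : List ℕ} {p : ℕ} {c : ℕ × ℕ} (h : c ∈ numbered p g) :
    ∃ i < g.length, c = (p * 2 ^ i, g.getD i 0) := by
  induction g generalizing p with
  | nil => simp [numbered] at h
  | cons r rs ih =>
    rcases List.mem_cons.1 h with rfl | h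
    · exact ⟨0, by simp, by simp⟩
    · obtain ⟨i, hi, rfl⟩ := ih h
      refine ⟨i + 1, by simpa using hi, ?_⟩
      simp [pow_succ]; ring

/-- The map `e` embeds the graph with rows `q` into the graph with rows `g`. -/
structure EmbedsVia (g q : List ℕ) (e : ℕ → ℕ) : Prop where
  lt : ∀ i < q.length, e i < g.length
  inj : ∀ i < q.length, ∀ j < i, e i ≠ e j
  adj : ∀ i < q.length, ∀ j < i,
    ((g.getD (e i) 0).testBit (e j) = true ↔ (q.getD i 0).testBit j = true)

theorem exists_embedsVia_of_embeds {g : List ℕ} (ps done : List ℕ) (e : ℕ → ℕ) (U : ℕ)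
    (hd : EmbedsVia g done e)
    (hU : ∀ v, U.testBit v = true ↔ ∃ j < done.length, e j = v)
    (h : embeds (numbered 1 g) ps done.length (singletons e done.length) U = true) :
    ∃ e', EmbedsVia g (done ++ ps) e' := by
  induction ps generalizing done e U with
  | nil => exact ⟨e, by simpa using hd⟩
  | cons p ps ih =>
    rw [embeds, List.any_eq_true] at h
    obtain ⟨c, hc, h⟩ := h
    obtain ⟨v, hv, rfl⟩ := mem_numbered hc
    simp only [one_mul, Bool.and_eq_true, Nat.beq_eq] at h
    obtain ⟨⟨h1, h2⟩, h3⟩ := h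
    have h1 : (g.getD v 0) &&& U = image p done.length (singletons e done.length) := h1
    have h2 : 2 ^ v &&& U = 0 := h2
    set k := done.length with hk
    have hvU : U.testBit v = false := by
      have := congrArg (Nat.testBit · v) h2
      simpa [Nat.testBit_two_pow] using this
    have hne : ∀ j < k, e j ≠ v := fun j hj hjv => by
      rw [(hU v).2 ⟨j, hj, hjv⟩] at hvU; cases hvU
    let e' : ℕ → ℕ := Function.update e k v
    have he' : ∀ j < k, e' j = e j := fun j hj => Function.update_of_ne hj.ne _ _
    have hek : e' k = v := Function.update_self _ _ _
    have hinj : ∀ i < k, ∀ j < k, e i = e j → i = j := by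
      intro i hi j hj hij
      rcases lt_trichotomy i j with hlt | rfl | hlt
      · exact absurd hij.symm (hd.inj j hj i hlt)
      · rfl
      · exact absurd hij (hd.inj i hi j hlt)
    have hadj : ∀ j < k, ((g.getD v 0).testBit (e j) = true ↔ p.testBit j = true) := by
      intro j hj
      have h4 : (g.getD v 0 &&& U).testBit (e j) = true ↔
          ∃ i < k, p.testBit i = true ∧ e i = e j := by
        rw [h1]; exact testBit_image p e k (e j)
      rw [Nat.testBit_and, (hU (e j)).2 ⟨j, hj, rfl⟩, Bool.and_true] at h4
      refine h4.trans ⟨?_, fun h => ⟨j, hj, h, rfl⟩⟩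
      rintro ⟨i, hi, hpi, hij⟩
      exact hinj i hi j hj hij ▸ hpi
    have hsing : ∀ n ≤ k, singletons e' n = singletons e n := by
      intro n
      induction n with
      | zero => intro _; rfl
      | succ n ihn => intro hn; simp only [singletons]; rw [he' n hn, ihn (by omega)]
    have hlen : (done ++ [p]).length = k + 1 := by simp [hk]
    have hlast : (done ++ [p]).getD k 0 = p := by simp [hk]
    have hfirst : ∀ i < k, (done ++ [p]).getD i 0 = done.getD i 0 := fun i hi => by
      simp [List.getElem?_append_left hi]
    have hd' : EmbedsVia g (done ++ [p]) e' := by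
      constructor <;> intro i hi <;> rw [hlen] at hi <;>
        rcases Nat.lt_succ_iff_lt_or_eq.1 hi with hi | rfl
      · rw [he' i hi]; exact hd.lt i hi
      · rwa [hek]
      · intro j hj
        rw [he' i hi, he' j (hj.trans hi)]; exact hd.inj i hi j hj
      · intro j hj
        rw [hek, he' j hj]; exact (hne j hj).symm
      · intro j hj
        rw [he' i hi, he' j (hj.trans hi), hfirst i hi]; exact hd.adj i hi j hj
      · intro j hj
        rw [hek, he' j hj, hlast]; exact hadj j hj
    have := ih (done ++ [p]) e' (Nat.lor U (2 ^ v)) hd' ?_ ?_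
    · simpa using this
    · intro w
      show (U ||| 2 ^ v).testBit w = true ↔ _
      rw [Nat.testBit_or, Bool.or_eq_true, hU, Nat.testBit_two_pow, decide_eq_true_iff, hlen]
      constructor
      · rintro (⟨j, hj, rfl⟩ | rfl)
        exacts [⟨j, hj.trans (Nat.lt_succ_self k), he' j hj⟩, ⟨k, Nat.lt_succ_self k, hek⟩]
      · rintro ⟨j, hj, rfl⟩
        rcases Nat.lt_succ_iff_lt_or_eq.1 hj with hj | rfl
        exacts [.inl ⟨j, hj, (he' j hj).symm⟩, .inr hek.symm]
    · rw [hlen]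
      simp only [singletons, hek]
      rw [hsing k le_rfl]
      exact h3

theorem EmbedsVia.realizes {g q : List ℕ} {e : ℕ → ℕ} {f : ℕ → V} (he : EmbedsVia g q e)
    (hg : WellFormed g) (h : Realizes G g f) : Realizes G q (f ∘ e) := by
  refine ⟨fun i hi j hj hij => he.inj i hi j hj ?_, fun i hi j hj => ?_⟩
  · exact h.eq_of_eq (he.lt i hi) (he.lt j (hj.trans hi)) hij
  · exact (h.adj_iff hg (he.lt i hi) (he.lt j (hj.trans hi))).trans (he.adj i hi j hj)

theorem exists_realizes_of_containsNth {L : List (List ℕ)} {k : ℕ} {g : List ℕ} {f : ℕ → V}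
    (h : containsNth L k g = true) (hg : WellFormed g) (hf : Realizes G g f) :
    ∃ q ∈ L, ∃ f', Realizes G q f' := by
  induction L generalizing k with
  | nil => simp [containsNth] at h
  | cons q L ih =>
    cases k with
    | zero =>
      obtain ⟨e, he⟩ := exists_embedsVia_of_embeds (g := g) q [] id 0
        ⟨by simp, by simp, by simp⟩ (by simp) h
      exact ⟨q, by simp, _, EmbedsVia.realizes (by simpa using he) hg hf⟩
    | succ k =>
      obtain ⟨q', hq', h'⟩ := ih h
      exact ⟨q', List.mem_cons_of_mem _ hq', h'⟩

theorem exists_containsNth_of_checkExt {L : List (List ℕ)} {rows : List ℕ} {bics : List (ℕ × ℕ)}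
    {T : List ℕ} {leaf : Bool} {n : ℕ} {ks : List ℕ}
    (h : checkExt L rows bics T leaf n ks = true) {S : ℕ} (hS : S < n) (hS0 : S ≠ 0) :
    (leaf = true ∧ covered rows bics S = false) ∨ S ∈ T ∨
      ∃ k, containsNth L k (addVertex rows S) = true := by
  induction n generalizing ks with
  | zero => simp at hS
  | succ n ih =>
    have hn0 : Nat.beq n 0 = false := by
      rw [← Bool.not_eq_true, Nat.beq_eq]
      omega
    rw [checkExt.eq_def] at h
    dsimp only at h
    rw [hn0, cond_false] at h
    cases h1 : leaf && !covered rows bics n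
    · rw [h1, cond_false] at h
      cases h2 : memB n T
      · rw [h2, cond_false] at h
        cases ks with
        | nil => simp at h
        | cons k ks =>
          simp only [Bool.and_eq_true] at h
          rcases Nat.lt_succ_iff_lt_or_eq.1 hS with hS | rfl
          exacts [ih h.2 hS, .inr (.inr ⟨k, h.1⟩)]
      · rw [h2, cond_true] at h
        rcases Nat.lt_succ_iff_lt_or_eq.1 hS with hS | rfl
        exacts [ih h hS, .inr (.inl (memB_iff.1 h2))]
    · rw [h1, cond_true] at h
      rcases Nat.lt_succ_iff_lt_or_eq.1 hS with hS | rfl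
      · exact ih h hS
      · simp only [Bool.and_eq_true, Bool.not_eq_true'] at h1
        exact .inl h1

theorem exists_containsNth_of_checkPairs {L gs : List (List ℕ)} {ks : List ℕ}
    (h : checkPairs L gs ks = true) {g : List ℕ} (hg : g ∈ gs) :
    ∃ k, containsNth L k g = true := by
  induction gs generalizing ks with
  | nil => simp at hg
  | cons a gs ih =>
    cases ks with
    | nil => simp [checkPairs] at h
    | cons k ks =>
      simp only [checkPairs, Bool.and_eq_true] at h
      rcases List.mem_cons.1 hg with rfl | hg
      exacts [⟨k, h.1⟩, ih h.2 hg]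

theorem pairExt_mem_pairExts {rows : List ℕ} {bics : List (ℕ × ℕ)} {T : List ℕ} {S S' : ℕ}
    (hS : S ∈ T) (hS' : S' ∈ T) :
    pairExt rows bics S S' ∈ pairExts rows bics T ∨
      pairExt rows bics S' S ∈ pairExts rows bics T := by
  induction T with
  | nil => simp at hS
  | cons a T ih =>
    rw [pairExts]
    rcases List.mem_cons.1 hS with rfl | hS1
    · exact .inl (List.mem_append_left _ (List.mem_map_of_mem hS'))
    · rcases List.mem_cons.1 hS' with rfl | hS1'
      · exact .inr (List.mem_append_left _ (List.mem_map_of_mem hS))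
      · exact (ih hS1 hS1').imp (fun h => List.mem_append_right _ (List.mem_cons_of_mem _ h))
          fun h => List.mem_append_right _ (List.mem_cons_of_mem _ h)

theorem pendant_mem_pairExts {rows : List ℕ} {bics : List (ℕ × ℕ)} {T : List ℕ} {S : ℕ}
    (hS : S ∈ T) : addVertex (addVertex rows S) (Nat.pow 2 rows.length) ∈
      pairExts rows bics T := by
  induction T with
  | nil => simp at hS
  | cons a T ih =>
    rw [pairExts]
    rcases List.mem_cons.1 hS with rfl | hS
    · exact List.mem_append_right _ (List.mem_cons_self ..)
    · exact List.mem_append_right _ (List.mem_cons_of_mem _ (ih hS))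

end SimpleGraph.Pattern

/-! ### Sets of vertices as masks -/

namespace SimpleGraph.Pattern
variable {V : Type*} {G : SimpleGraph V}

/-- The set of vertices encoded by the mask `n` along `f`. -/
def maskSet (f : ℕ → V) (n : ℕ) : Set V := f '' {i | n.testBit i = true}

theorem lt_of_testBit {n m i : ℕ} (hn : n < 2 ^ m) (hi : n.testBit i = true) : i < m := by
  by_contra h
  rw [Nat.testBit_lt_two_pow (hn.trans_le (Nat.pow_le_pow_right two_pos (not_lt.1 h)))] at hi
  cases hi

theorem ne_zero_of_testBit {n i : ℕ} (hi : n.testBit i = true) : n ≠ 0 := by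
  rintro rfl
  simp at hi

theorem maskSet_lor (f : ℕ → V) (a b : ℕ) :
    maskSet f (a ||| b) = maskSet f a ∪ maskSet f b := by
  rw [maskSet, maskSet, maskSet, ← Set.image_union]
  congr 1
  ext i
  simp

/-- The masks `A.1` and `A.2` are disjoint sets of the first `m` vertices. -/
structure SidesBelow (m : ℕ) (A : ℕ × ℕ) : Prop where
  lt : A.1 ||| A.2 < 2 ^ m
  disjoint : ∀ i, A.1.testBit i = true → A.2.testBit i = false

theorem SidesBelow.left_lt {m : ℕ} {A : ℕ × ℕ} (h : SidesBelow m A) {i : ℕ}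
    (hi : A.1.testBit i = true) : i < m :=
  lt_of_testBit h.lt (by rw [Nat.testBit_or, hi, Bool.true_or])

theorem SidesBelow.right_lt {m : ℕ} {A : ℕ × ℕ} (h : SidesBelow m A) {i : ℕ}
    (hi : A.2.testBit i = true) : i < m :=
  lt_of_testBit h.lt (by rw [Nat.testBit_or, hi, Bool.or_true])

theorem SidesBelow.swap {m : ℕ} {A : ℕ × ℕ} (h : SidesBelow m A) : SidesBelow m A.swap :=
  ⟨by rw [Prod.fst_swap, Prod.snd_swap, Nat.lor_comm]; exact h.lt, fun i hi => by
    by_contra hi'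
    have := h.disjoint i (by simpa using hi')
    rw [Prod.fst_swap, this] at hi
    cases hi⟩

theorem and_eq_right_iff {f : ℕ → V} {m : ℕ} {A : ℕ × ℕ} (hA : SidesBelow m A) {v : V} {S : ℕ}
    (hS : IsType G f m v S) :
    S &&& (A.1 ||| A.2) = A.2 ↔ G.Joins (maskSet f A.1) (maskSet f A.2) v := by
  constructor
  · intro h
    have key : ∀ i, (S.testBit i && (A.1.testBit i || A.2.testBit i)) = A.2.testBit i := by
      intro i
      rw [← Nat.testBit_or, ← Nat.testBit_and, h]
    refine ⟨?_, ?_⟩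
    · rintro _ ⟨i, hi, rfl⟩ hv
      have hi : A.1.testBit i = true := hi
      have := key i
      rw [(hS.2 i (hA.left_lt hi)).2 hv, hi, hA.disjoint i hi] at this
      cases this
    · rintro _ ⟨i, hi, rfl⟩
      have hi : A.2.testBit i = true := hi
      refine (hS.2 i (hA.right_lt hi)).1 ?_
      have := key i
      rw [hi] at this
      simpa using this
  · rintro ⟨h1, h2⟩
    refine Nat.eq_of_testBit_eq fun i => ?_
    rw [Nat.testBit_and, Nat.testBit_or]
    cases hi : A.2.testBit i
    · cases hi' : A.1.testBit i
      · simp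
      · have : S.testBit i = false := by
          rw [← Bool.not_eq_true]
          exact fun h => h1 _ ⟨i, hi', rfl⟩ ((hS.2 i (hA.left_lt hi')).1 h)
        simp [this]
    · simp [(hS.2 i (hA.right_lt hi)).2 (h2 _ ⟨i, hi, rfl⟩)]

theorem and_eq_left_iff {f : ℕ → V} {m : ℕ} {A : ℕ × ℕ} (hA : SidesBelow m A) {v : V} {S : ℕ}
    (hS : IsType G f m v S) :
    S &&& (A.1 ||| A.2) = A.1 ↔ G.Joins (maskSet f A.2) (maskSet f A.1) v := by
  rw [Nat.lor_comm]
  exact and_eq_right_iff hA.swap hS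

theorem validBicAux_iff {A : ℕ × ℕ} {i : ℕ} {g : List ℕ} :
    validBicAux A i g = true ↔ ∀ k < g.length,
      ((g.getD k 0 &&& (A.1 ||| A.2) = A.2 ↔ A.1.testBit (i + k) = true) ∧
        (g.getD k 0 &&& (A.1 ||| A.2) = A.1 ↔ A.2.testBit (i + k) = true)) := by
  induction g generalizing i with
  | nil => simp [validBicAux]
  | cons r rs ih =>
    have hb : ∀ (b : Bool) (x y : ℕ), boolEq (Nat.beq x y) b = true ↔ (x = y ↔ b = true) := by
      intro b x y
      rw [boolEq_iff, Bool.eq_iff_iff, Nat.beq_eq]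
    rw [validBicAux, Bool.and_eq_true, Bool.and_eq_true, hb, hb, ih, bit_eq, bit_eq]
    constructor
    · rintro ⟨h1, h2⟩ (_ | k) hk
      · exact h1
      · have := h2 k (by simpa using hk)
        rwa [Nat.succ_eq_add_one, Nat.add_right_comm] at this
    · refine fun h => ⟨h 0 (by simp), fun k hk => ?_⟩
      have := h (k + 1) (by simpa using hk)
      rwa [Nat.succ_eq_add_one, Nat.add_right_comm]

theorem ValidBic.sidesBelow {g : List ℕ} (hg : WellFormed g) {A : ℕ × ℕ}
    (h : validBic g A = true) : SidesBelow g.length A := by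
  simp only [validBic, Bool.and_eq_true, Nat.blt_eq, validBicAux_iff] at h
  obtain ⟨⟨-, hlt⟩, hA⟩ := h
  have hlt : A.1 ||| A.2 < 2 ^ g.length := hlt
  refine ⟨hlt, fun i hi => ?_⟩
  rw [← Bool.not_eq_true]
  intro hi'
  have hig : i < g.length := lt_of_testBit hlt (by rw [Nat.testBit_or, hi, Bool.true_or])
  have h1 := (hA i hig).2.2 (by simpa using hi')
  have := congrArg (Nat.testBit · i) h1
  simp [hi, hig] at this
  have hirr := hg.irrefl i hig
  simp [hig] at hirr
  rw [hirr] at this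
  cases this

theorem bicliqueIn_of_validBic {g : List ℕ} {f : ℕ → V} (hg : WellFormed g)
    (hf : Realizes G g f) {A : ℕ × ℕ} (h : validBic g A = true) :
    G.BicliqueIn (f '' {i | i < g.length}) (maskSet f A.1) (maskSet f A.2) := by
  have hA := ValidBic.sidesBelow hg h
  simp only [validBic, Bool.and_eq_true, Nat.blt_eq, validBicAux_iff, Bool.not_eq_true',
    ← Bool.not_eq_true, Nat.beq_eq, zero_add] at h
  obtain ⟨⟨⟨h1, h2⟩, -⟩, h3⟩ := h
  have hl : ∀ i < g.length,
      (G.Joins (maskSet f A.1) (maskSet f A.2) (f i) ↔ A.1.testBit i = true) :=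
    fun i hi => (and_eq_right_iff hA (hf.isType hg hi)).symm.trans (h3 i hi).1
  have hr : ∀ i < g.length,
      (G.Joins (maskSet f A.2) (maskSet f A.1) (f i) ↔ A.2.testBit i = true) :=
    fun i hi => (and_eq_left_iff hA (hf.isType hg hi)).symm.trans (h3 i hi).2
  refine ⟨⟨?_, ?_, ?_, ?_, ?_⟩, ?_, ?_, ?_, ?_⟩
  · obtain ⟨i, hi⟩ := Nat.exists_testBit_of_ne_zero h1
    exact ⟨f i, i, hi, rfl⟩
  · obtain ⟨i, hi⟩ := Nat.exists_testBit_of_ne_zero h2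
    exact ⟨f i, i, hi, rfl⟩
  · rintro _ ⟨i, hi, rfl⟩ v hv
    exact ((hl i (hA.left_lt hi)).2 hi).1 v hv
  · rintro _ ⟨i, hi, rfl⟩ v hv
    exact ((hr i (hA.right_lt hi)).2 hi).1 v hv
  · rintro _ ⟨i, hi, rfl⟩ v hv
    exact ((hl i (hA.left_lt hi)).2 hi).2 v hv
  · rintro _ ⟨i, hi, rfl⟩
    exact ⟨i, hA.left_lt hi, rfl⟩
  · rintro _ ⟨i, hi, rfl⟩
    exact ⟨i, hA.right_lt hi, rfl⟩
  · rintro _ ⟨i, hi, rfl⟩ hj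
    exact ⟨i, (hl i hi).1 hj, rfl⟩
  · rintro _ ⟨i, hi, rfl⟩ hj
    exact ⟨i, (hr i hi).1 hj, rfl⟩

theorem maskSet_injective {g : List ℕ} {f : ℕ → V} (hf : Realizes G g f) {a b : ℕ}
    (ha : a < 2 ^ g.length) (hb : b < 2 ^ g.length) (h : maskSet f a = maskSet f b) : a = b := by
  have key : ∀ {a b}, a < 2 ^ g.length → b < 2 ^ g.length → maskSet f a = maskSet f b →
      ∀ i, a.testBit i = true → b.testBit i = true := by
    intro a b ha hb h i hi
    obtain ⟨j, hj, hij⟩ := h.subset ⟨i, hi, rfl⟩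
    have hj : b.testBit j = true := hj
    rwa [hf.eq_of_eq (lt_of_testBit hb hj) (lt_of_testBit ha hi) hij] at hj
  exact Nat.eq_of_testBit_eq fun i => Bool.eq_iff_iff.2 ⟨key ha hb h i, key hb ha h.symm i⟩

theorem mem_joined {S : ℕ} {As : List (ℕ × ℕ)} {A : ℕ × ℕ} (h : A ∈ joined S As) :
    (A ∈ As ∨ A.swap ∈ As) ∧ S &&& (A.1 ||| A.2) = A.2 := by
  induction As with
  | nil => simp [joined] at h
  | cons B As ih =>
    have hw : (A ∈ As ∨ A.swap ∈ As) → (A ∈ B :: As ∨ A.swap ∈ B :: As) :=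
      Or.imp (List.mem_cons_of_mem _) (List.mem_cons_of_mem _)
    rw [joined] at h
    cases h1 : Nat.beq (Nat.land S (Nat.lor B.1 B.2)) B.2
    · rw [h1, cond_false] at h
      cases h2 : Nat.beq (Nat.land S (Nat.lor B.1 B.2)) B.1
      · rw [h2, cond_false] at h
        exact (ih h).imp_left hw
      · rw [h2, cond_true] at h
        rcases List.mem_cons.1 h with rfl | h
        · refine ⟨.inr (List.mem_cons_self ..), ?_⟩
          rw [Nat.lor_comm]
          exact Nat.beq_eq.mp h2
        · exact (ih h).imp_left hw
    · rw [h1, cond_true] at h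
      rcases List.mem_cons.1 h with rfl | h
      · exact ⟨.inl (List.mem_cons_self ..), Nat.beq_eq.mp h1⟩
      · exact (ih h).imp_left hw

theorem mem_joined_of_mem {S : ℕ} {As : List (ℕ × ℕ)} {A : ℕ × ℕ}
    (hne : ∀ B ∈ As, B.1 ≠ B.2) (hA : A ∈ As ∨ A.swap ∈ As) (h : S &&& (A.1 ||| A.2) = A.2) :
    A ∈ joined S As := by
  induction As with
  | nil => simp at hA
  | cons B As ih =>
    have ih := ih fun B hB => hne B (List.mem_cons_of_mem _ hB)
    have hA' : (A = B ∨ A.swap = B) ∨ (A ∈ As ∨ A.swap ∈ As) := by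
      rcases hA with hA | hA <;> rcases List.mem_cons.1 hA with hA | hA
      exacts [.inl (.inl hA), .inr (.inl hA), .inl (.inr hA), .inr (.inr hA)]
    rw [joined]
    rcases hA' with (rfl | rfl) | hA
    · have : Nat.beq (Nat.land S (Nat.lor A.1 A.2)) A.2 = true := Nat.beq_eq.mpr h
      rw [this, cond_true]
      exact List.mem_cons_self ..
    · have h2 : Nat.beq (Nat.land S (Nat.lor A.2 A.1)) A.2 = true :=
        Nat.beq_eq.mpr ((congrArg (S &&& ·) (Nat.lor_comm _ _)).trans h)
      have h1 : Nat.beq (Nat.land S (Nat.lor A.2 A.1)) A.1 = false := by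
        rw [← Bool.not_eq_true, Nat.beq_eq, Nat.beq_eq.mp h2]
        exact hne _ (List.mem_cons_self ..)
      simp only [Prod.fst_swap, Prod.snd_swap, h1, h2, cond_true, cond_false]
      exact List.mem_cons_self ..
    · cases Nat.beq (Nat.land S (Nat.lor B.1 B.2)) B.2
      · cases Nat.beq (Nat.land S (Nat.lor B.1 B.2)) B.1
        · exact ih hA
        · exact List.mem_cons_of_mem _ (ih hA)
      · exact List.mem_cons_of_mem _ (ih hA)

theorem testBit_reach {h j : ℕ} {J : List (ℕ × ℕ)} :
    (reach h J).testBit j = true ↔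
      ∃ A ∈ J, A.2.testBit h = true ∧ (A.1.testBit j = true ∨ A.2.testBit j = true) := by
  induction J with
  | nil => simp [reach]
  | cons A J ih =>
    rw [List.exists_mem_cons_iff, ← ih, reach, bit_eq]
    cases h1 : A.2.testBit h <;> simp

theorem coveredAux_iff {J : List (ℕ × ℕ)} {S i : ℕ} {g : List ℕ} :
    coveredAux J S i g = true ↔ ∀ k < g.length, S.testBit (i + k) = true →
      ∀ j, (g.getD k 0).testBit j ≠ S.testBit j → (reach (i + k) J).testBit j = true := by
  induction g generalizing i with
  | nil => simp [coveredAux]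
  | cons r rs ih =>
    have hsub : ∀ a b : ℕ, Nat.beq (Nat.land a b) a = true ↔
        ∀ j, a.testBit j = true → b.testBit j = true := by
      intro a b
      rw [Nat.beq_eq]
      constructor
      · intro h j hj
        have h : a &&& b = a := h
        rw [← h] at hj
        simp at hj
        exact hj.2
      · intro h
        refine Nat.eq_of_testBit_eq (x := a &&& b) fun j => ?_
        rw [Nat.testBit_and]
        cases hj : a.testBit j
        · rfl
        · simp [h j hj]
    have hx : ∀ j, (Nat.xor r S).testBit j = true ↔ r.testBit j ≠ S.testBit j := by
      intro j
      show (r ^^^ S).testBit j = true ↔ _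
      rw [Nat.testBit_xor]
      simp
    rw [coveredAux, Bool.and_eq_true, ih, bit_eq]
    have h0 : (bif S.testBit i then
        Nat.beq (Nat.land (Nat.xor r S) (reach i J)) (Nat.xor r S) else true) = true ↔
        (S.testBit i = true → ∀ j, r.testBit j ≠ S.testBit j → (reach i J).testBit j = true) := by
      cases S.testBit i
      · simp
      · simp only [cond_true, hsub, hx, true_implies]
    rw [h0]
    constructor
    · rintro ⟨h1, h2⟩ (_ | k) hk
      · exact h1
      · have := h2 k (by simpa using hk)
        rwa [Nat.succ_eq_add_one, Nat.add_right_comm] at this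
    · refine fun h => ⟨h 0 (by simp), fun k hk => ?_⟩
      have := h (k + 1) (by simpa using hk)
      rwa [Nat.succ_eq_add_one, Nat.add_right_comm]

theorem covered_iff {g : List ℕ} {As : List (ℕ × ℕ)} {S : ℕ} :
    covered g As S = true ↔ ∀ k < g.length, S.testBit k = true →
      ∀ j, (g.getD k 0).testBit j ≠ S.testBit j → ∃ A ∈ joined S As, A.2.testBit k = true ∧
        (A.1.testBit j = true ∨ A.2.testBit j = true) := by
  simp only [covered, coveredAux_iff, zero_add, testBit_reach]

end SimpleGraph.Pattern

/-! ### Bicliques of an occurring pattern -/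

namespace SimpleGraph.Pattern
variable {V : Type*} {G : SimpleGraph V}

/-- The first sides of the bicliques of a pattern, as sets of vertices of `G`. -/
def leftSide (P : Pattern) (f : ℕ → V) (i : Fin P.bics.length) : Set V :=
  maskSet f (P.bics.get i).1

/-- The second sides of the bicliques of a pattern, as sets of vertices of `G`. -/
def rightSide (P : Pattern) (f : ℕ → V) (i : Fin P.bics.length) : Set V :=
  maskSet f (P.bics.get i).2

/-- The vertices of `G` onto which `f` maps the pattern. -/
def core (P : Pattern) (f : ℕ → V) : Set V := f '' {i | i < P.rows.length}

/-- A valid pattern together with a realization of it in `G`. -/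
structure Occurs (G : SimpleGraph V) (P : Pattern) (f : ℕ → V) : Prop where
  valid : P.valid = true
  realizes : Realizes G P.rows f

namespace Occurs

variable {P : Pattern} {f : ℕ → V}

theorem wellFormed (h : Occurs G P f) : WellFormed P.rows := by
  have := h.valid
  simp only [Pattern.valid, Bool.and_eq_true] at this
  exact wellFormed_of_validRows this.1.1

theorem validBic (h : Occurs G P f) {A : ℕ × ℕ} (hA : A ∈ P.bics) :
    Pattern.validBic P.rows A = true := by
  have := h.valid
  simp only [Pattern.valid, Bool.and_eq_true] at this
  exact List.all_eq_true.1 this.1.2 A hA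

theorem sidesBelow (h : Occurs G P f) {A : ℕ × ℕ} (hA : A ∈ P.bics) :
    SidesBelow P.rows.length A :=
  ValidBic.sidesBelow h.wellFormed (h.validBic hA)

theorem bicliqueIn (h : Occurs G P f) (i : Fin P.bics.length) :
    G.BicliqueIn (P.core f) (P.leftSide f i) (P.rightSide f i) :=
  bicliqueIn_of_validBic h.wellFormed h.realizes (h.validBic (List.get_mem _ _))

theorem eq_of_union_eq (h : Occurs G P f) (i j : Fin P.bics.length)
    (hij : P.leftSide f i ∪ P.rightSide f i = P.leftSide f j ∪ P.rightSide f j) : i = j := by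
  have hv := h.valid
  simp only [Pattern.valid, Bool.and_eq_true, nodupB_iff] at hv
  rw [leftSide, rightSide, leftSide, rightSide, ← maskSet_lor, ← maskSet_lor] at hij
  have := maskSet_injective h.realizes (h.sidesBelow (List.get_mem _ i)).lt
    (h.sidesBelow (List.get_mem _ j)).lt hij
  have := List.nodup_iff_injective_get.1 hv.2
    (a₁ := ⟨i, by simp⟩) (a₂ := ⟨j, by simp⟩) (by simpa using this)
  exact Fin.ext (by simpa using this)

theorem ne_sides (h : Occurs G P f) : ∀ A ∈ P.bics, A.1 ≠ A.2 := by
  rintro A hA heq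
  have h1 := h.validBic hA
  simp only [Pattern.validBic, Bool.and_eq_true, Bool.not_eq_true', ← Bool.not_eq_true,
    Nat.beq_eq] at h1
  obtain ⟨i, hi⟩ := Nat.exists_testBit_of_ne_zero h1.1.1.1
  have := (h.sidesBelow hA).disjoint i hi
  rw [← heq, hi] at this
  cases this

theorem swap_sidesBelow (h : Occurs G P f) {A : ℕ × ℕ} (hA : A ∈ P.bics ∨ A.swap ∈ P.bics) :
    SidesBelow P.rows.length A :=
  hA.elim h.sidesBelow fun hA => by simpa using (h.sidesBelow hA).swap

/-- A vertex with a covered type is joined to each neighbour in the pattern through a biclique of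
the pattern. -/
theorem exists_joins_of_covered (h : Occurs G P f) {v : V} {S : ℕ}
    (hS : IsType G f P.rows.length v S) (hc : covered P.rows P.bics S = true) {r : V}
    (hr : r ∈ P.core f) (hvr : G.Adj v r) :
    ∃ i, (G.Joins (P.leftSide f i) (P.rightSide f i) v ∧ r ∈ P.rightSide f i) ∨
      (G.Joins (P.rightSide f i) (P.leftSide f i) v ∧ r ∈ P.leftSide f i) := by
  obtain ⟨k, hk, rfl⟩ := hr
  have hk : k < P.rows.length := hk
  have hSk : S.testBit k = true := (hS.2 k hk).2 hvr
  obtain ⟨A, hA, hAk, -⟩ := covered_iff.1 hc k hk hSk k (by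
    rw [h.wellFormed.irrefl k hk, hSk]; decide)
  obtain ⟨hmem, hSA⟩ := mem_joined hA
  have hj := (and_eq_right_iff (h.swap_sidesBelow hmem) hS).1 hSA
  rcases hmem with hmem | hmem <;> obtain ⟨i, hi⟩ := List.get_of_mem hmem
  · refine ⟨i, .inl ?_⟩
    rw [leftSide, rightSide, hi]
    exact ⟨hj, k, hAk, rfl⟩
  · refine ⟨i, .inr ?_⟩
    rw [leftSide, rightSide, hi]
    exact ⟨hj, k, hAk, rfl⟩

/-- A vertex whose type is not covered forces a biclique beyond those of the pattern. -/
theorem length_lt_of_not_covered [Finite V] (h : Occurs G P f) {v : V} {S : ℕ}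
    (hS : IsType G f P.rows.length v S) (hc : covered P.rows P.bics S = false) :
    P.bics.length < {C : Set V | G.IsBiclique C}.ncard := by
  rw [← Bool.not_eq_true, covered_iff] at hc
  push Not at hc
  obtain ⟨k, hk, hSk, j, hj, hn⟩ := hc
  have hjlt : j < P.rows.length := by
    by_contra hlt
    have hle := Nat.pow_le_pow_right two_pos (not_lt.1 hlt)
    rw [Nat.testBit_lt_two_pow ((h.wellFormed.lt k hk).trans_le hle),
      Nat.testBit_lt_two_pow (hS.1.trans_le hle)] at hj
    exact hj rfl
  -- a biclique that `v` joins with `f k` on the other side does not contain `f j`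
  have key : ∀ A : ℕ × ℕ, (A ∈ P.bics ∨ A.swap ∈ P.bics) →
      G.Joins (maskSet f A.1) (maskSet f A.2) v → f k ∈ maskSet f A.2 →
      f j ∉ maskSet f A.1 ∪ maskSet f A.2 := by
    intro A hA hv hfk hfj
    have hAb := h.swap_sidesBelow hA
    have hAj := mem_joined_of_mem h.ne_sides hA ((and_eq_right_iff hAb hS).2 hv)
    have hbit : ∀ i n, i < P.rows.length → n < 2 ^ P.rows.length → f i ∈ maskSet f n →
        n.testBit i = true := by
      rintro i n hi hn ⟨i', hi', heq⟩
      have hi' : n.testBit i' = true := hi'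
      rwa [h.realizes.eq_of_eq (lt_of_testBit hn hi') hi heq] at hi'
    have hle1 : A.1 < 2 ^ P.rows.length := Nat.left_le_or.trans_lt hAb.lt
    have hle2 : A.2 < 2 ^ P.rows.length := Nat.right_le_or.trans_lt hAb.lt
    obtain ⟨h1, h2⟩ := hn A hAj (hbit k _ hk hle2 hfk)
    rcases hfj with hfj | hfj
    exacts [h1 (hbit j _ hjlt hle1 hfj), h2 (hbit j _ hjlt hle2 hfj)]
  have := card_lt_of_path (z := v) h.bicliqueIn h.eq_of_union_eq ⟨k, hk, rfl⟩ ⟨j, hjlt, rfl⟩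
    ((hS.2 k hk).1 hSk)
    (by
      rw [h.realizes.adj_iff h.wellFormed hk hjlt, ← hS.2 j hjlt]
      exact fun hiff => hj (Bool.eq_iff_iff.2 hiff))
    fun i => ⟨fun hi => key _ (.inl (List.get_mem _ i)) hi.1 hi.2.1 hi.2.2,
      fun hi => key (P.bics.get i).swap (.inr (List.get_mem _ i)) hi.1 hi.2.1
        (by rw [Set.union_comm]; exact hi.2.2)⟩
  simpa using this

theorem opposite_iff (h : Occurs G P f) {u v : V} {S S' : ℕ}
    (hS : IsType G f P.rows.length u S) (hS' : IsType G f P.rows.length v S') :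
    opposite P.bics S S' = true ↔
      ∃ i, (G.Joins (P.leftSide f i) (P.rightSide f i) u ∧
          G.Joins (P.rightSide f i) (P.leftSide f i) v) ∨
        (G.Joins (P.rightSide f i) (P.leftSide f i) u ∧
          G.Joins (P.leftSide f i) (P.rightSide f i) v) := by
  have key : ∀ A ∈ P.bics,
      (((Nat.beq (Nat.land S (Nat.lor A.1 A.2)) A.2 &&
          Nat.beq (Nat.land S' (Nat.lor A.1 A.2)) A.1) ||
        (Nat.beq (Nat.land S (Nat.lor A.1 A.2)) A.1 &&
          Nat.beq (Nat.land S' (Nat.lor A.1 A.2)) A.2)) = true ↔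
      (G.Joins (maskSet f A.1) (maskSet f A.2) u ∧ G.Joins (maskSet f A.2) (maskSet f A.1) v) ∨
      (G.Joins (maskSet f A.2) (maskSet f A.1) u ∧
        G.Joins (maskSet f A.1) (maskSet f A.2) v)) := by
    intro A hA
    have hAb := h.sidesBelow hA
    rw [← and_eq_right_iff hAb hS, ← and_eq_left_iff hAb hS, ← and_eq_right_iff hAb hS',
      ← and_eq_left_iff hAb hS']
    simp only [Bool.or_eq_true, Bool.and_eq_true, Nat.beq_eq]
    rfl
  rw [opposite, List.any_eq_true]
  constructor
  · rintro ⟨A, hA, hAo⟩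
    obtain ⟨i, rfl⟩ := List.get_of_mem hA
    exact ⟨i, (key _ hA).1 hAo⟩
  · rintro ⟨i, hi⟩
    exact ⟨_, List.get_mem _ i, (key _ (List.get_mem _ i)).2 hi⟩

theorem opposite_comm (h : Occurs G P f) {u v : V} {S S' : ℕ}
    (hS : IsType G f P.rows.length u S) (hS' : IsType G f P.rows.length v S') :
    opposite P.bics S S' = opposite P.bics S' S := by
  rw [Bool.eq_iff_iff, h.opposite_iff hS hS', h.opposite_iff hS' hS]
  exact exists_congr fun i => by tauto

end Occurs

end SimpleGraph.Pattern

/-! ### Soundness of the test -/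

namespace SimpleGraph
variable {V : Type*} {G : SimpleGraph V}

/-- `G` is a counterexample to the lower bound of seven bicliques. -/
structure Counterexample [Fintype V] (G : SimpleGraph V) : Prop where
  connected : G.Connected
  twinFree : G.FalseTwinFree
  card : 13 ≤ Fintype.card V
  few : {C : Set V | G.IsBiclique C}.ncard ≤ 6

theorem Counterexample.exists_adj [Fintype V] (hG : Counterexample G) (v : V) :
    ∃ w, G.Adj v w := by
  have : Nontrivial V := Fintype.one_lt_card_iff_nontrivial.1 (by have := hG.card; omega)
  exact hG.connected.preconnected.exists_adj_of_nontrivial v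

namespace Pattern

/-- The bicliques of an occurring pattern determine the adjacency of all vertices: adjacent vertices
join opposite sides of one of them, and vertices joining opposite sides are adjacent. -/
structure Determines (G : SimpleGraph V) (P : Pattern) (f : ℕ → V) : Prop where
  edge : ∀ u v, G.Adj u v → ∃ i, (G.Joins (P.leftSide f i) (P.rightSide f i) u ∧
      G.Joins (P.rightSide f i) (P.leftSide f i) v) ∨
    (G.Joins (P.rightSide f i) (P.leftSide f i) u ∧ G.Joins (P.leftSide f i) (P.rightSide f i) v)
  adj : ∀ i u v, G.Joins (P.leftSide f i) (P.rightSide f i) u →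
    G.Joins (P.rightSide f i) (P.leftSide f i) v → G.Adj u v

variable {P : Pattern} {f : ℕ → V}

/-- No graph of the list occurs in `G` as an induced subgraph. -/
def Avoids (G : SimpleGraph V) (L : List (List ℕ)) : Prop :=
  ∀ q ∈ L, ∀ f, ¬ Realizes G q f

theorem Avoids.not_containsNth {L : List (List ℕ)} (hL : Avoids G L) {k : ℕ} {g : List ℕ}
    (h : containsNth L k g = true) (hg : WellFormed g) {f : ℕ → V} : ¬ Realizes G g f := by
  intro hf
  obtain ⟨q, hq, f', hf'⟩ := exists_realizes_of_containsNth h hg hf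
  exact hL q hq f' hf'

theorem isType_ne_zero {m S : ℕ} {v r : V} (hS : IsType G f m v S) (hr : r ∈ f '' {i | i < m})
    (hvr : G.Adj v r) : S ≠ 0 := by
  obtain ⟨i, hi, rfl⟩ := hr
  exact ne_zero_of_testBit ((hS.2 i hi).2 hvr)

theorem Determines.isType_ne_zero (hD : Determines G P f) (h : Occurs G P f) {v w : V}
    (hvw : G.Adj v w) {S : ℕ} (hS : IsType G f P.rows.length v S) : S ≠ 0 := by
  obtain ⟨i, hi | hi⟩ := hD.edge v w hvw
  · obtain ⟨r, hr⟩ := (h.bicliqueIn i).sides.2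
    exact Pattern.isType_ne_zero hS ((h.bicliqueIn i).3 hr) (hi.1.2 r hr)
  · obtain ⟨r, hr⟩ := (h.bicliqueIn i).sides.1
    exact Pattern.isType_ne_zero hS ((h.bicliqueIn i).2 hr) (hi.1.2 r hr)

/-- With the adjacency determined by the pattern, distinct vertices have distinct types. -/
theorem Determines.card_le [Fintype V] (hD : Determines G P f) (h : Occurs G P f)
    (htwin : G.FalseTwinFree) {T : List ℕ}
    (hT : ∀ v S, IsType G f P.rows.length v S → S ∈ T) : Fintype.card V ≤ T.length := by
  choose S hS using exists_isType G f P.rows.length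
  have hinj : Function.Injective S := by
    intro u v huv
    refine eq_of_adj_iff_adj htwin h.bicliqueIn hD.edge hD.adj ?_
    rintro _ ⟨i, hi, rfl⟩
    rw [← (hS u).2 i hi, ← (hS v).2 i hi, huv]
  calc Fintype.card V = (Finset.univ : Finset V).card := rfl
    _ ≤ T.toFinset.card := Finset.card_le_card_of_injOn S
        (fun v _ => by simpa using hT v _ (hS v)) hinj.injOn
    _ ≤ T.length := T.toFinset_card_le

/-- With six bicliques in the pattern already, there is no room for a further one. -/
theorem determines_of_six [Finite V] (h : Occurs G P f)
    (hle : {C : Set V | G.IsBiclique C}.ncard ≤ P.bics.length) : Determines G P f := by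
  constructor
  · intro u v huv
    by_contra hn
    push Not at hn
    have := card_lt_of_adj h.bicliqueIn h.eq_of_union_eq huv
      fun i => ⟨fun hi => (hn i).1 hi.1 hi.2, fun hi => (hn i).2 hi.1 hi.2⟩
    rw [Fintype.card_fin] at this
    omega
  · intro i u v hu hv
    by_contra huv
    have := card_lt_of_not_adj h.bicliqueIn h.eq_of_union_eq hu hv huv
    rw [Fintype.card_fin] at this
    omega

section Check

variable {L : List (List ℕ)}

/-- The listed types of a pattern that passes the test are the only non-empty ones. -/
theorem Occurs.mem_types [Finite V] (h : Occurs G P f) (hL : Avoids G L)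
    (hrows : ∀ r ∈ P.rows, r ∈ P.types) {leaf : Bool} {ks : List ℕ}
    (hext : checkExt L P.rows P.bics P.types leaf (2 ^ P.rows.length) ks = true)
    (hleaf : leaf = true → {C : Set V | G.IsBiclique C}.ncard ≤ P.bics.length)
    {v : V} {S : ℕ} (hS : IsType G f P.rows.length v S) (hS0 : S ≠ 0) : S ∈ P.types := by
  by_cases hv : v ∈ P.core f
  · obtain ⟨i, hi, rfl⟩ := hv
    have hi : i < P.rows.length := hi
    rw [hS.unique (h.realizes.isType h.wellFormed hi), List.getD_eq_getElem _ _ hi]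
    exact hrows _ (List.getElem_mem hi)
  · rcases exists_containsNth_of_checkExt hext hS.1 hS0 with ⟨hl, hc⟩ | hT | ⟨k, hk⟩
    · exact absurd (h.length_lt_of_not_covered hS hc) (not_lt.2 (hleaf hl))
    · exact hT
    · exact absurd (h.realizes.addVertex (fun i hi hiv => hv ⟨i, hi, hiv⟩) hS)
        (hL.not_containsNth hk (h.wellFormed.addVertex hS.1))

/-- The graph obtained by adding `u` and `v`, with types `S` and `S'`, where the last digit records
whether `u` and `v` are adjacent. -/
theorem Occurs.realizes_pair (h : Occurs G P f) {u v : V} {S S' S'' : ℕ}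
    (hu : u ∉ P.core f) (hv : v ∉ P.core f) (huv : u ≠ v) (hS : IsType G f P.rows.length u S)
    (hS' : IsType G f P.rows.length v S')
    (hlow : ∀ i < P.rows.length, S''.testBit i = S'.testBit i)
    (hhigh : S''.testBit P.rows.length = true ↔ G.Adj v u) (hlt : S'' < 2 ^ (P.rows.length + 1)) :
    WellFormed (addVertex (addVertex P.rows S) S'') ∧
      ∃ f', Realizes G (addVertex (addVertex P.rows S) S'') f' := by
  have hlen := length_addVertex P.rows S
  have h1 := h.realizes.addVertex (fun i hi hiu => hu ⟨i, hi, hiu⟩) hS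
  refine ⟨(h.wellFormed.addVertex hS.1).addVertex (by rwa [hlen]), _,
    h1.addVertex (z := v) ?_ ⟨by rwa [hlen], ?_⟩⟩ <;> intro i hi <;> rw [hlen] at hi <;>
    rcases Nat.lt_succ_iff_lt_or_eq.1 hi with hi | rfl
  · rw [Function.update_of_ne hi.ne]
    exact fun hiv => hv ⟨i, hi, hiv⟩
  · rwa [Function.update_self]
  · rw [Function.update_of_ne hi.ne, hlow i hi, hS'.2 i hi]
  · rw [Function.update_self, hhigh]

theorem IsType.not_testBit {m S : ℕ} {v : V} (hS : IsType G f m v S) :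
    S.testBit m = false := Nat.testBit_lt_two_pow hS.1

/-- For each pair of types, the test excludes the adjacency that contradicts the bicliques of the
pattern, so that only the other one is left. -/
theorem Occurs.adj_iff_opposite (h : Occurs G P f) (hL : Avoids G L) {ks : List ℕ}
    (hp : checkPairs L (pairExts P.rows P.bics P.types) ks = true) {u v : V} {S S' : ℕ}
    (hu : u ∉ P.core f) (hv : v ∉ P.core f) (huv : u ≠ v) (hS : IsType G f P.rows.length u S)
    (hS' : IsType G f P.rows.length v S') (hST : S ∈ P.types) (hST' : S' ∈ P.types) :
    G.Adj u v ↔ opposite P.bics S S' = true := by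
  have key : ∀ {u v : V} {S S' : ℕ}, u ∉ P.core f → v ∉ P.core f → u ≠ v →
      IsType G f P.rows.length u S → IsType G f P.rows.length v S' →
      pairExt P.rows P.bics S S' ∈ pairExts P.rows P.bics P.types →
      (G.Adj u v ↔ opposite P.bics S S' = true) := by
    intro u v S S' hu hv huv hS hS' hmem
    obtain ⟨k, hk⟩ := exists_containsNth_of_checkPairs hp hmem
    rw [pairExt] at hk
    have hlt : S' < 2 ^ (P.rows.length + 1) :=
      hS'.1.trans (Nat.pow_lt_pow_right one_lt_two (Nat.lt_succ_self _))
    cases ho : opposite P.bics S S'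
    · rw [ho, cond_false] at hk
      refine iff_of_false (fun hadj => ?_) Bool.false_ne_true
      obtain ⟨hw, f', hf'⟩ := h.realizes_pair (S'' := S' ||| 2 ^ P.rows.length) hu hv huv hS hS'
        (fun i hi => by simp [hi.ne'])
        (by simpa using hadj.symm)
        (Nat.or_lt_two_pow hlt (Nat.pow_lt_pow_right one_lt_two (Nat.lt_succ_self _)))
      exact hL.not_containsNth hk hw hf'
    · rw [ho, cond_true] at hk
      refine iff_of_true (by_contra fun hadj => ?_) rfl
      obtain ⟨hw, f', hf'⟩ := h.realizes_pair (S'' := S') hu hv huv hS hS'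
        (fun i hi => rfl)
        (by rw [hS'.not_testBit, G.adj_comm]; simpa using hadj) hlt
      exact hL.not_containsNth hk hw hf'
  rcases pairExt_mem_pairExts (rows := P.rows) (bics := P.bics) hST hST' with hm | hm
  · exact key hu hv huv hS hS' hm
  · rw [G.adj_comm, h.opposite_comm hS hS']
    exact key hv hu huv.symm hS' hS hm

/-- If the extensions by one and by two vertices that contradict the conclusion are excluded, the
pattern determines the adjacency of all vertices. Connectedness enters here: it reduces the
exclusion of vertices without neighbours in the pattern to that of pendant paths. -/
theorem Occurs.determines [Finite V] (h : Occurs G P f) (hL : Avoids G L) (hconn : G.Connected)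
    (hrows : ∀ r ∈ P.rows, r ∈ P.types) {ks ks' : List ℕ}
    (hext : checkExt L P.rows P.bics P.types false (2 ^ P.rows.length) ks = true)
    (hcov : ∀ S ∈ P.types, covered P.rows P.bics S = true) (hpos : 1 ≤ P.rows.length)
    (h0 : 0 ∉ P.types) (hp : checkPairs L (pairExts P.rows P.bics P.types) ks' = true) :
    Determines G P f := by
  have hmem : ∀ {v S}, IsType G f P.rows.length v S → S ≠ 0 → S ∈ P.types :=
    fun hS hS0 => h.mem_types hL hrows hext (by simp) hS hS0
  have hcore : ∀ {i S}, i < P.rows.length → IsType G f P.rows.length (f i) S → S ≠ 0 := by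
    rintro i S hi hS rfl
    rw [hS.unique (h.realizes.isType h.wellFormed hi), List.getD_eq_getElem _ _ hi] at h0
    exact h0 (hrows _ (List.getElem_mem hi))
  have hne : ∀ {v S}, IsType G f P.rows.length v S → S ≠ 0 := by
    rintro v S hS rfl
    obtain ⟨p⟩ := hconn.preconnected v (f 0)
    obtain ⟨d, -, hd1, hd2⟩ := p.exists_boundary_dart {x | IsType G f P.rows.length x 0} hS
      fun h0 => hcore (i := 0) hpos h0 rfl
    have hd1 : IsType G f P.rows.length d.fst 0 := hd1
    obtain ⟨S, hS⟩ := exists_isType G f P.rows.length d.snd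
    have hS0 : S ≠ 0 := fun hS0 => hd2 (hS0 ▸ hS)
    have hd1' : d.fst ∉ P.core f := by
      rintro ⟨i, hi, heq⟩
      exact hcore (i := i) hi (heq.symm ▸ hd1) rfl
    have hd2' : d.snd ∉ P.core f := fun hr => Pattern.isType_ne_zero hd1 hr d.adj rfl
    obtain ⟨k, hk⟩ := exists_containsNth_of_checkPairs hp (pendant_mem_pairExts (hmem hS hS0))
    obtain ⟨hw, f', hf'⟩ := h.realizes_pair (S'' := 2 ^ P.rows.length) hd2' hd1' d.adj.ne' hS hd1
      (fun i hi => by simp [hi.ne'])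
      (by simp [d.adj]) (Nat.pow_lt_pow_right one_lt_two (Nat.lt_succ_self _))
    exact hL.not_containsNth hk hw hf'
  constructor
  · intro u v huv
    obtain ⟨S, hS⟩ := exists_isType G f P.rows.length u
    obtain ⟨S', hS'⟩ := exists_isType G f P.rows.length v
    by_cases hv : v ∈ P.core f
    · obtain ⟨i, hi⟩ := h.exists_joins_of_covered hS (hcov S (hmem hS (hne hS))) hv huv
      exact ⟨i, hi.imp (fun hi => ⟨hi.1, (h.bicliqueIn i).sides.symm.joins_left hi.2⟩)
        fun hi => ⟨hi.1, (h.bicliqueIn i).sides.joins_left hi.2⟩⟩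
    by_cases hu : u ∈ P.core f
    · obtain ⟨i, hi⟩ := h.exists_joins_of_covered hS' (hcov S' (hmem hS' (hne hS'))) hu huv.symm
      exact ⟨i, hi.symm.imp (fun hi => ⟨(h.bicliqueIn i).sides.joins_left hi.2, hi.1⟩)
        fun hi => ⟨(h.bicliqueIn i).sides.symm.joins_left hi.2, hi.1⟩⟩
    exact (h.opposite_iff hS hS').1 ((h.adj_iff_opposite hL hp hu hv huv.ne hS hS'
      (hmem hS (hne hS)) (hmem hS' (hne hS'))).1 huv)
  · intro i u v hju hjv
    obtain ⟨S, hS⟩ := exists_isType G f P.rows.length u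
    obtain ⟨S', hS'⟩ := exists_isType G f P.rows.length v
    by_cases hu : u ∈ P.core f
    · exact (hjv.2 u ((h.bicliqueIn i).4 u hu hju)).symm
    by_cases hv : v ∈ P.core f
    · exact hju.2 v ((h.bicliqueIn i).5 v hv hjv)
    have huv : u ≠ v := by
      rintro rfl
      obtain ⟨x, hx⟩ := (h.bicliqueIn i).sides.1
      exact hju.1 x hx (hjv.2 x hx)
    exact (h.adj_iff_opposite hL hp hu hv huv hS hS' (hmem hS (hne hS)) (hmem hS' (hne hS'))).2
      ((h.opposite_iff hS hS').2 ⟨i, .inl ⟨hju, hjv⟩⟩)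

/-- Soundness of `check`: a pattern that passes the test is not an induced subgraph of a
counterexample, if the graphs in `L` are not. With seven bicliques it contradicts the bound on their
number, and otherwise it determines the adjacency in `G` and leaves at most twelve types. -/
theorem not_realizes_of_check [Fintype V] (hG : Counterexample G) (hL : Avoids G L)
    (hc : check L P = true) (f : ℕ → V) : ¬ Realizes G P.rows f := by
  intro hf
  simp only [check, Bool.and_eq_true, Bool.or_eq_true] at hc
  obtain ⟨hv, hc⟩ := hc
  have h : Occurs G P f := ⟨hv, hf⟩
  rcases hc with h7 | ⟨⟨⟨h12, hrows⟩, hext⟩, hc⟩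
  · have h7 : 7 ≤ P.bics.length := Nat.ble_eq.mp h7
    have := card_le_of_bicliqueIn h.bicliqueIn h.eq_of_union_eq
    rw [Fintype.card_fin] at this
    have := hG.few
    omega
  · have h12 : P.types.length ≤ 12 := Nat.ble_eq.mp h12
    have hrows : ∀ r ∈ P.rows, r ∈ P.types :=
      fun r hr => memB_iff.1 (List.all_eq_true.1 hrows r hr)
    have hleaf : Nat.beq P.bics.length 6 = true →
        {C : Set V | G.IsBiclique C}.ncard ≤ P.bics.length := by
      intro h6
      rw [Nat.beq_eq.mp h6]
      exact hG.few
    have hD : Determines G P f := by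
      cases h6 : Nat.beq P.bics.length 6
      · rw [h6] at hext hc
        rcases hc with hc | ⟨⟨⟨hcov, hpos⟩, h0⟩, hp⟩
        · exact absurd hc Bool.false_ne_true
        · exact h.determines hL hG.connected hrows hext (List.all_eq_true.1 hcov)
            (Nat.ble_eq.mp hpos) (by simpa [← memB_iff] using h0) hp
      · exact determines_of_six h (hleaf h6)
    have := hD.card_le h hG.twinFree fun v S hS =>
      h.mem_types hL hrows hext hleaf hS (by
        obtain ⟨w, hw⟩ := hG.exists_adj v
        exact hD.isType_ne_zero h hw hS)
    have := hG.card
    omega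

theorem not_realizes_of_checkList [Fintype V] (hG : Counterexample G) {Ps : List Pattern}
    (hL : Avoids G L) (hc : checkList L Ps = true) :
    ∀ P ∈ Ps, ∀ f : ℕ → V, ¬ Realizes G P.rows f := by
  induction Ps generalizing L with
  | nil => simp
  | cons P Ps ih =>
    simp only [checkList, Bool.and_eq_true] at hc
    have hP := not_realizes_of_check hG hL hc.1
    intro Q hQ
    rcases List.mem_cons.1 hQ with rfl | hQ
    · exact hP
    · refine ih ?_ hc.2 Q hQ
      intro q hq
      rcases List.mem_cons.1 hq with rfl | hq
      exacts [hP, hL q hq]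

end Check

end Pattern

end SimpleGraph

/-! ### The patterns -/

namespace SimpleGraph
namespace Pattern

/-- The triangle, as a pattern. -/
def triangle : Pattern :=
  ⟨[6, 5, 3], [(1, 2), (1, 4), (2, 4)], [6, 5, 4, 3, 2, 1], [100], [100, 64, 64, 64, 64, 76, 76,
    100, 64, 64, 76, 64, 76, 98, 76, 24, 24, 0, 100, 64, 64, 76, 98, 24, 0, 98, 0]⟩

/-- The patterns other than the triangle that the argument rules out, each with the help of the
earlier ones. The fields are, in this order, the rows, the bicliques, the types and the two lists of
witnesses; a witness `k` stands for the pattern `k + 1` places earlier in the list. -/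
def derivedPatterns : List Pattern := [
  ⟨[62, 29, 11, 7, 3, 1], [(4, 8), (2, 20), (2, 24), (1, 34), (1, 52), (1, 56)], [62, 60, 56, 52,
    34, 29, 11, 7, 3, 1], [], []⟩,
  ⟨[30, 13, 11, 7, 1], [(2, 4), (2, 8), (4, 8), (1, 18), (1, 20), (1, 24)], [30, 28, 26, 24, 22,
    20, 18, 13, 11, 7, 3, 1], [0, 0], []⟩,
  ⟨[14, 13, 11, 7], [(1, 2), (1, 4), (2, 4), (1, 8), (2, 8), (4, 8)], [14, 13, 12, 11, 10, 9, 7, 6,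
    5, 3, 2, 1], [0, 0], []⟩,
  ⟨[30, 37, 3, 49, 9, 10], [(1, 12), (1, 18), (1, 20), (2, 36), (33, 10), (8, 48)], [52, 49, 37,
    33, 30, 26, 14, 10, 9, 3, 1], [], []⟩,
  ⟨[30, 5, 3, 17, 9], [(2, 4), (1, 10), (1, 12), (1, 18), (1, 20), (8, 16)], [30, 28, 26, 22, 17,
    14, 12, 10, 9, 5, 3, 1], [0, 0], []⟩,
  ⟨[30, 45, 19, 35, 5, 10], [(1, 12), (2, 12), (1, 18), (18, 4), (1, 24), (33, 2), (2, 36),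
    (33, 8)], [], [], []⟩,
  ⟨[30, 53, 11, 5, 3, 2], [(1, 10), (10, 4), (1, 20), (1, 24), (33, 2), (2, 52)], [53, 52, 33, 30,
    26, 11, 10, 5, 3, 2, 1], [], []⟩,
  ⟨[14, 13, 19, 35, 4, 8], [(1, 2), (1, 12), (2, 12), (17, 4), (18, 4), (33, 8), (34, 8)], [], [],
    []⟩,
  ⟨[30, 21, 11, 37, 3, 8], [(1, 10), (10, 4), (1, 20), (2, 20), (1, 24), (33, 8), (36, 8)], [], [],
    []⟩,
  ⟨[30, 21, 11, 37, 35, 24], [(1, 10), (10, 4), (1, 20), (2, 20), (36, 8), (34, 16), (33, 24)], [],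
    [], []⟩,
  ⟨[38, 13, 3, 18, 40, 17], [(9, 2), (2, 12), (18, 8), (1, 34), (1, 36), (17, 32), (40, 16)], [],
    [], []⟩,
  ⟨[38, 13, 11, 22, 40, 17], [(2, 4), (9, 2), (9, 4), (18, 8), (20, 8), (1, 34), (1, 36), (17, 32),
    (40, 16)], [], [], []⟩,
  ⟨[30, 53, 43, 21, 11, 6], [(1, 10), (1, 20), (10, 20), (33, 2), (33, 4), (4, 40), (2, 48)], [],
    [], []⟩,
  ⟨[78, 45, 19, 3, 4, 2, 1], [(17, 4), (18, 4), (33, 2), (2, 44), (1, 66), (1, 76)], [78, 66, 45,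
    33, 19, 18, 17, 4, 3, 2, 1], [], []⟩,
  ⟨[38, 21, 11, 4, 2, 1], [(9, 4), (10, 4), (17, 2), (2, 20), (1, 34), (1, 36)], [38, 36, 34, 21,
    20, 17, 11, 10, 9, 4, 2, 1], [0, 0, 0], []⟩,
  ⟨[14, 13, 19, 3, 36, 16], [(1, 2), (1, 12), (2, 12), (17, 4), (18, 4), (36, 16)], [36, 19, 18,
    17, 16, 14, 13, 12, 4, 3, 2, 1], [], []⟩,
  ⟨[118, 45, 27, 54, 13, 11, 1], [(18, 4), (9, 18), (2, 36), (9, 36), (9, 48), (1, 82), (1, 100),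
    (1, 112)], [], [], []⟩,
  ⟨[78, 29, 51, 19, 14, 4, 1], [(2, 12), (17, 2), (17, 12), (34, 4), (49, 4), (1, 66), (1, 76)],
    [], [], []⟩,
  ⟨[46, 77, 19, 3, 36, 17, 2], [(18, 4), (1, 34), (1, 44), (17, 36), (65, 2), (2, 76)], [77, 65,
    50, 46, 36, 19, 17, 3, 2, 1], [], []⟩,
  ⟨[78, 53, 11, 21, 10, 2, 1], [(17, 10), (10, 20), (49, 2), (2, 52), (1, 68), (1, 74)], [78, 74,
    53, 49, 21, 17, 11, 10, 2, 1], [], []⟩,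
  ⟨[30, 13, 35, 3, 97, 20, 16], [(2, 12), (1, 18), (1, 28), (34, 4), (33, 20), (97, 16)], [97, 35,
    33, 30, 28, 20, 18, 16, 13, 3, 1], [], []⟩,
  ⟨[30, 29, 99, 35, 3, 12, 4], [(1, 2), (1, 28), (2, 28), (33, 12), (34, 12), (97, 4), (98, 4)],
    [], [], []⟩,
  ⟨[46, 85, 11, 5, 34, 17, 2], [(10, 4), (1, 36), (1, 42), (17, 34), (81, 2), (2, 84)], [85, 81,
    46, 42, 34, 17, 11, 5, 2, 1], [], []⟩,
  ⟨[78, 53, 11, 21, 10, 66, 33], [(17, 10), (10, 20), (49, 2), (2, 52), (1, 68), (1, 74),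
    (33, 66)], [], [], []⟩,
  ⟨[30, 13, 35, 3, 65, 4, 16], [(2, 12), (1, 18), (1, 28), (33, 4), (34, 4), (65, 16)], [65, 35,
    33, 30, 28, 18, 16, 13, 4, 3, 1], [], []⟩,
  ⟨[54, 13, 11, 22, 73, 1, 16], [(2, 4), (9, 18), (9, 20), (1, 50), (1, 52), (73, 16)], [73, 54,
    52, 50, 22, 20, 18, 16, 13, 11, 9, 1], [], []⟩,
  ⟨[14, 13, 19, 3, 4], [(1, 2), (1, 12), (2, 12), (17, 4), (18, 4)], [19, 18, 17, 14, 13, 12, 4, 3,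
    2, 1], [23, 13, 13, 21, 23, 16, 16, 14, 23, 20, 20, 21, 10, 23, 23, 17, 17, 18, 23, 19, 19],
    [23, 20, 20, 17, 17, 18, 4, 23, 19, 19, 4, 21, 15, 17, 10, 2, 3, 16, 21, 7, 5, 21, 10, 17, 2,
    3, 16, 7, 21, 5, 23, 9, 9, 13, 19, 19, 8, 8, 23, 9, 13, 19, 8, 19, 8, 21, 21, 4, 6, 6, 0, 21,
    4, 3, 3, 10, 23, 17, 17, 18, 21, 11, 1, 21, 1]⟩,
  ⟨[62, 21, 11, 37, 35, 25], [(1, 10), (10, 4), (1, 20), (2, 20), (1, 24), (1, 34), (1, 36),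
    (36, 8), (34, 16), (24, 32)], [], [], []⟩,
  ⟨[30, 53, 43, 5, 3, 6], [(1, 10), (10, 4), (1, 20), (2, 20), (1, 24), (33, 2), (33, 4), (4, 40),
    (2, 48)], [], [], []⟩,
  ⟨[110, 117, 27, 53, 78, 11, 19], [(17, 10), (10, 36), (10, 48), (17, 68), (17, 72), (1, 100),
    (2, 100)], [], [], []⟩,
  ⟨[94, 53, 11, 37, 3, 10, 1], [(33, 10), (10, 36), (2, 52), (1, 74), (1, 84), (1, 88)], [94, 90,
    74, 53, 37, 33, 11, 10, 3, 1], [], []⟩,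
  ⟨[94, 109, 19, 35, 37, 26, 3], [(33, 18), (18, 36), (33, 24), (1, 76), (2, 76), (1, 88),
    (2, 100)], [], [], []⟩,
  ⟨[30, 45, 83, 99, 37, 26, 12], [(33, 18), (18, 36), (33, 24), (65, 12), (66, 12), (82, 4),
    (97, 8)], [], [], []⟩,
  ⟨[126, 45, 83, 19, 13, 3, 5], [(18, 12), (1, 44), (2, 44), (1, 82), (82, 4), (1, 104), (1, 112)],
    [], [], []⟩,
  ⟨[46, 53, 11, 21, 74, 3, 16], [(17, 10), (10, 20), (1, 36), (1, 40), (2, 52), (74, 16)], [74, 53,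
    52, 46, 42, 21, 17, 16, 11, 10, 3], [], []⟩,
  ⟨[30, 85, 43, 101, 99, 92, 58], [(33, 20), (34, 20), (33, 24), (65, 10), (10, 68), (65, 24),
    (34, 68)], [], [], []⟩,
  ⟨[62, 21, 11, 5, 3, 65, 32], [(10, 4), (2, 20), (1, 42), (1, 52), (1, 56), (65, 32)], [65, 62,
    60, 58, 52, 42, 32, 21, 11, 5, 3, 1], [], []⟩,
  ⟨[30, 85, 43, 69, 35, 20, 10], [(1, 24), (42, 4), (33, 20), (34, 20), (65, 10), (10, 68),
    (2, 84)], [], [], []⟩,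
  ⟨[30, 21, 11, 5, 3], [(1, 10), (10, 4), (1, 20), (2, 20), (1, 24)], [30, 28, 26, 21, 20, 11, 10,
    5, 3, 1], [35, 35, 35, 10, 28, 35, 25, 35, 32, 33, 11, 35, 25, 33, 11, 33, 29, 35, 9, 11, 31],
    [35, 35, 35, 8, 8, 8, 8, 25, 25, 21, 11, 33, 2, 8, 33, 11, 5, 6, 11, 31, 29, 33, 25, 5, 8, 33,
    32, 6, 31, 29, 35, 11, 33, 11, 35, 4, 4, 11, 33, 11, 0, 6, 11, 7, 3, 35, 11, 4, 35, 4, 11, 33,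
    31, 6, 7, 3, 33, 4, 33, 29, 35, 33, 11, 33, 1]⟩,
  ⟨[14, 37, 19, 49, 76, 10, 16], [(18, 4), (17, 12), (2, 36), (33, 10), (49, 8), (76, 16)], [76,
    51, 49, 44, 37, 19, 16, 14, 12, 10, 8], [], []⟩,
  ⟨[102, 21, 11, 52, 74, 9, 17], [(10, 20), (9, 36), (52, 8), (17, 66), (74, 16), (1, 98),
    (1, 100)], [], [], []⟩,
  ⟨[86, 13, 35, 50, 9, 12, 1], [(9, 18), (33, 4), (34, 12), (50, 8), (1, 82), (1, 84)], [86, 50,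
    41, 35, 13, 12, 9, 8, 1], [], []⟩,
  ⟨[86, 37, 11, 84, 41, 18, 9], [(10, 4), (2, 36), (33, 18), (41, 16), (1, 82), (9, 84)], [90, 86,
    84, 43, 41, 37, 18, 16, 11, 9, 5], [], []⟩,
  ⟨[114, 5, 10, 20, 9, 65, 33], [(5, 2), (10, 4), (9, 16), (20, 8), (1, 50), (1, 82), (32, 64)],
    [], [], []⟩,
  ⟨[114, 13, 42, 22, 9, 5, 129, 64], [(9, 18), (20, 8), (5, 34), (4, 40), (1, 114), (129, 64)],
    [129, 114, 64, 42, 22, 13, 9, 5, 1], [], []⟩,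
  ⟨[78, 177, 41, 21, 74, 70, 49, 2], [(20, 8), (4, 40), (17, 74), (33, 70), (49, 66), (177, 2)],
    [177, 78, 74, 70, 66, 57, 53, 49, 41, 21, 2], [], []⟩,
  ⟨[14, 37, 19, 49, 12, 10], [(18, 4), (17, 12), (2, 36), (33, 10), (49, 8)], [53, 51, 49, 44, 37,
    26, 19, 14, 12, 10, 8], [43, 7, 7, 41, 7, 41, 41, 35, 43, 19, 41, 41, 35, 43, 7, 7, 19, 41, 41,
    35, 43, 19, 5, 19, 41, 3, 6, 43, 7, 19, 41, 7, 41, 35, 43, 19, 19, 41, 5, 3, 6, 43, 19, 19, 41,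
    43, 19, 19, 4, 19, 4, 31], [43, 7, 7, 7, 43, 19, 7, 7, 7, 19, 7, 19, 43, 7, 19, 7, 7, 43, 7,
    19, 7, 7, 19, 41, 5, 7, 5, 7, 19, 3, 3, 0, 0, 41, 7, 41, 19, 7, 41, 5, 19, 31, 43, 19, 7, 7, 7,
    19, 19, 19, 41, 7, 7, 5, 41, 19, 31, 43, 7, 19, 7, 19, 19, 43, 7, 7, 19, 19, 41, 5, 35, 6, 41,
    35, 6, 2, 1]⟩,
  ⟨[22, 37, 11, 84, 9, 2, 8], [(10, 4), (1, 18), (9, 20), (33, 2), (2, 36), (84, 8)], [84, 37, 22,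
    20, 11, 10, 9, 8, 5, 2], [], []⟩,
  ⟨[22, 37, 11, 20, 9, 66, 32], [(10, 4), (1, 18), (9, 20), (33, 2), (2, 36), (66, 32)], [66, 37,
    32, 26, 22, 20, 11, 9, 5, 2], [], []⟩,
  ⟨[86, 37, 11, 20, 9, 66, 33], [(10, 4), (9, 20), (2, 36), (1, 82), (1, 84), (33, 66)], [86, 66,
    37, 33, 20, 11, 9, 5, 3, 1], [], []⟩,
  ⟨[22, 69, 11, 52, 41, 24, 2], [(10, 4), (1, 18), (9, 20), (36, 8), (33, 16), (65, 2), (2, 68)],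
    [], [], []⟩,
  ⟨[78, 177, 41, 21, 42, 22, 1, 2], [(17, 10), (33, 6), (20, 40), (1, 70), (1, 74), (145, 2),
    (161, 2)], [], [], []⟩,
  ⟨[22, 37, 11, 20, 9, 2], [(10, 4), (1, 18), (9, 20), (33, 2), (2, 36)], [37, 26, 22, 20, 11, 9,
    5, 2], [49, 13, 13, 47, 13, 47, 47, 41, 49, 13, 13, 5, 25, 5, 47, 41, 49, 25, 13, 47, 13, 47,
    9, 41, 49, 25, 2, 25, 47, 2, 3, 49, 13, 25, 47, 13, 47, 1, 49, 25, 25, 5, 47, 4, 49, 25, 25,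
    37, 10, 4, 49, 25, 37, 25, 37], [49, 28, 13, 13, 13, 13, 49, 32, 25, 47, 13, 5, 13, 10, 25, 47,
    0, 49, 13, 5, 32, 25, 13, 25, 47, 25, 37, 25, 10, 4, 49, 13, 13, 13, 25, 47, 25, 9, 4, 25, 32,
    25, 47, 3]⟩,
  ⟨[38, 13, 3, 18, 72, 1, 16], [(9, 2), (2, 12), (18, 8), (1, 34), (1, 36), (72, 16)], [72, 38, 34,
    18, 16, 13, 9, 8, 3, 2, 1], [], []⟩,
  ⟨[14, 21, 3, 65, 34, 16, 8], [(1, 10), (1, 12), (17, 2), (2, 20), (34, 16), (65, 8)], [65, 34,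
    21, 17, 16, 14, 10, 8, 3, 2, 1], [], []⟩,
  ⟨[70, 13, 3, 50, 40, 24, 1], [(9, 2), (2, 12), (18, 8), (34, 8), (16, 32), (1, 66), (1, 68)], [],
    [], []⟩,
  ⟨[14, 21, 3, 65, 34, 80, 40], [(1, 10), (1, 12), (17, 2), (2, 20), (34, 16), (65, 8), (40, 64),
    (80, 32)], [], [], []⟩,
  ⟨[86, 13, 3, 50, 41, 24, 1], [(2, 12), (9, 18), (34, 8), (33, 16), (1, 82), (1, 84)], [86, 82,
    50, 41, 35, 24, 18, 13, 9, 3, 1], [], []⟩,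
  ⟨[46, 21, 3, 81, 10, 65, 40], [(2, 20), (17, 10), (1, 42), (1, 44), (81, 8), (65, 40)], [81, 65,
    46, 42, 40, 21, 17, 10, 8, 3, 1], [], []⟩,
  ⟨[30, 69, 3, 161, 33, 24, 2, 8], [(1, 26), (1, 28), (33, 24), (65, 2), (2, 68), (161, 8)], [161,
    69, 65, 33, 30, 26, 24, 8, 3, 2, 1], [], []⟩,
  ⟨[102, 29, 3, 130, 34, 17, 1, 8], [(25, 2), (2, 28), (17, 34), (1, 98), (1, 100), (130, 8)],
    [130, 102, 98, 34, 29, 25, 17, 8, 3, 2, 1], [], []⟩,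
  ⟨[46, 21, 3, 145, 10, 65, 32, 8], [(2, 20), (17, 10), (1, 42), (1, 44), (65, 32), (145, 8)],
    [145, 65, 46, 42, 32, 21, 17, 10, 8, 3, 1], [], []⟩,
  ⟨[54, 13, 3, 82, 137, 1, 8, 16], [(2, 12), (9, 18), (1, 50), (1, 52), (82, 8), (137, 16)], [137,
    82, 54, 50, 18, 16, 13, 9, 8, 3, 1], [], []⟩,
  ⟨[54, 77, 3, 146, 9, 65, 34, 8], [(9, 18), (1, 50), (1, 52), (73, 2), (2, 76), (65, 34),
    (146, 8)], [], [], []⟩,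
  ⟨[54, 141, 3, 82, 9, 1, 8, 2], [(9, 18), (1, 50), (1, 52), (82, 8), (137, 2), (2, 140)], [141,
    137, 82, 54, 50, 18, 9, 8, 3, 2, 1], [], []⟩,
  ⟨[30, 37, 3, 65, 129, 2, 8, 16], [(1, 26), (1, 28), (33, 2), (2, 36), (65, 8), (129, 16)], [129,
    65, 37, 33, 30, 26, 16, 8, 3, 2, 1], [], []⟩,
  ⟨[22, 13, 3, 34, 1, 8], [(9, 2), (2, 12), (1, 18), (1, 20), (34, 8)], [34, 22, 18, 13, 9, 8, 3,
    2, 1], [63, 27, 27, 19, 27, 61, 61, 55, 63, 39, 39, 13, 27, 7, 61, 9, 63, 39, 39, 13, 39, 61,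
    8, 10, 63, 39, 39, 51, 39, 55, 12, 63, 27, 27, 19, 27, 61, 61, 55, 63, 39, 13, 27, 61, 11, 63,
    39, 13, 27, 61, 63, 39, 39, 51], [61, 27, 61, 46, 7, 6, 27, 61, 7, 6, 63, 27, 13, 42, 39, 27,
    27, 46, 39, 61, 42, 2, 7, 27, 61, 5, 4, 63, 27, 39, 27, 46, 27, 39, 61, 8, 27, 1, 61, 3, 10,
    39, 6, 55, 12, 63, 27, 27, 51, 61, 5, 0, 61, 11]⟩,
  ⟨[86, 45, 3, 18, 9, 66, 33], [(9, 18), (41, 2), (2, 44), (1, 82), (1, 84), (33, 66)], [86, 82,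
    66, 45, 41, 33, 18, 9, 3, 2, 1], [], []⟩,
  ⟨[214, 301, 3, 82, 41, 18, 9, 1, 2], [(41, 18), (9, 82), (1, 210), (1, 212), (297, 2), (2, 300)],
    [301, 297, 214, 210, 82, 41, 18, 9, 3, 2, 1], [], []⟩,
  ⟨[174, 85, 3, 337, 42, 17, 10, 1, 8], [(17, 42), (2, 84), (81, 10), (1, 170), (1, 172),
    (337, 8)], [337, 174, 170, 85, 81, 42, 17, 10, 8, 3, 1], [], []⟩,
  ⟨[54, 77, 3, 18, 9, 1, 2], [(9, 18), (1, 50), (1, 52), (73, 2), (2, 76)], [77, 73, 54, 50, 18, 9,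
    3, 2, 1], [67, 31, 31, 23, 31, 65, 65, 59, 67, 31, 43, 23, 31, 65, 65, 11, 67, 43, 31, 29, 31,
    65, 65, 59, 67, 46, 46, 17, 31, 2, 65, 59, 67, 43, 31, 28, 31, 65, 65, 3, 67, 43, 50, 23, 31,
    65, 65, 59, 67, 43, 28, 31, 65, 3, 67, 47, 46, 55, 31, 65, 2, 3, 67, 31, 43, 17, 31, 65, 65,
    59, 67, 43, 23, 31, 65, 11, 67, 50, 43, 55, 31, 65, 65, 59, 67, 46, 47, 17, 31, 2, 65, 3, 67,
    50, 50, 17, 31, 65, 65, 3, 67, 50, 43, 23, 31, 65, 3, 67, 43, 50, 55, 31, 65, 3, 67, 47, 47,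
    55], [67, 31, 23, 46, 50, 31, 31, 50, 31, 43, 65, 46, 2, 2, 65, 31, 1, 65, 0, 67, 31, 31, 50,
    31, 31, 50, 43, 65, 65, 2, 31, 65, 1, 0, 65, 1, 31, 65, 1, 3, 65, 31, 1, 65, 3, 67, 31, 31, 55,
    65, 2, 3, 65, 3]⟩,
  ⟨[78, 53, 3, 177, 202, 10, 17, 24], [(2, 52), (49, 10), (1, 76), (17, 74), (161, 8), (194, 16)],
    [202, 177, 78, 74, 53, 49, 24, 17, 10, 3], [], []⟩,
  ⟨[78, 21, 3, 49, 10, 136, 1, 32], [(2, 20), (17, 10), (49, 8), (1, 74), (1, 76), (136, 32)],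
    [136, 78, 74, 49, 32, 21, 17, 10, 8, 3, 1], [], []⟩,
  ⟨[142, 113, 25, 5, 6, 66, 34, 1], [(17, 6), (4, 24), (49, 2), (81, 2), (32, 64), (1, 134),
    (1, 138)], [], [], []⟩,
  ⟨[118, 13, 3, 50, 137, 265, 1, 16, 32], [(2, 12), (9, 50), (1, 114), (1, 116), (137, 16),
    (265, 32)], [265, 137, 118, 114, 50, 32, 16, 13, 9, 3, 1], [], []⟩,
  ⟨[78, 53, 3, 177, 330, 10, 17, 8, 16], [(2, 52), (49, 10), (1, 76), (17, 74), (177, 8),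
    (330, 16)], [330, 177, 78, 74, 53, 49, 17, 16, 10, 8, 3], [], []⟩,
  ⟨[182, 329, 41, 22, 73, 5, 18, 1, 2], [(9, 22), (4, 40), (73, 18), (1, 150), (1, 178), (329, 2)],
    [329, 182, 150, 73, 41, 22, 18, 9, 5, 2, 1], [], []⟩,
  ⟨[46, 21, 3, 81, 10, 1, 8], [(2, 20), (17, 10), (1, 42), (1, 44), (81, 8)], [81, 46, 42, 21, 17,
    10, 8, 3, 1], [74, 38, 38, 50, 38, 72, 72, 66, 74, 65, 38, 36, 38, 66, 72, 66, 74, 50, 50, 30,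
    38, 5, 72, 18, 74, 65, 50, 24, 38, 9, 72, 33, 74, 50, 38, 10, 38, 10, 72, 10, 74, 65, 50, 35,
    50, 66, 10, 74, 50, 50, 30, 38, 10, 72, 3, 74, 65, 50, 62, 62, 6, 18, 4, 74, 38, 38, 30, 38,
    72, 72, 66, 74, 50, 38, 36, 38, 72, 72, 66, 74, 50, 30, 38, 72, 18, 74, 53, 50, 24, 38, 9, 72,
    15, 74, 51, 38, 25, 38, 72, 72, 10, 74, 50, 35, 51, 72, 10, 74, 51, 50, 30, 38, 72, 74, 54, 50,
    62, 6], [72, 50, 9, 38, 72, 6, 0, 38, 72, 0, 74, 38, 30, 51, 38, 50, 38, 51, 50, 72, 53, 9, 72,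
    5, 38, 7, 1, 74, 38, 57, 50, 38, 38, 50, 72, 7, 0, 38, 72, 2, 72, 10, 51, 7, 10, 3, 62, 18, 4,
    74, 38, 62, 72, 15]⟩,
  ⟨[22, 13, 3, 2, 1], [(9, 2), (2, 12), (1, 18), (1, 20)], [22, 18, 13, 9, 3, 2, 1], [75, 39, 39,
    31, 39, 73, 73, 67, 75, 51, 25, 39, 73, 11, 75, 51, 25, 39, 73, 11, 75, 51, 51, 63], [75, 39,
    25, 54, 39, 39, 58, 51, 73, 54, 10, 39, 73, 7, 0, 75, 39, 39, 58, 39, 51, 73, 39, 7, 73, 0, 75,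
    39, 39, 63, 73, 7, 11, 73, 11]⟩,
  ⟨[14, 49, 9, 5, 34, 18], [(1, 6), (1, 10), (4, 8), (17, 2), (33, 2), (16, 32)], [49, 34, 33, 18,
    17, 14, 10, 9, 6, 5, 2, 1], [], []⟩,
  ⟨[54, 13, 3, 114, 73, 137, 24, 32], [(2, 12), (1, 52), (9, 50), (65, 16), (98, 8), (137, 32)],
    [137, 114, 73, 54, 50, 32, 24, 13, 9, 3], [], []⟩,
  ⟨[22, 13, 3, 50, 41, 24], [(2, 12), (1, 20), (9, 18), (34, 8), (33, 16)], [50, 41, 35, 28, 24,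
    22, 18, 13, 9, 3], [78, 42, 42, 78, 42, 76, 76, 1, 78, 54, 54, 34, 42, 2, 1, 78, 69, 54, 2, 54,
    2, 1, 78, 69, 54, 2, 2, 2, 2, 78, 42, 42, 42, 76, 76, 78, 54, 34, 42, 2, 2, 78, 54, 2, 42, 2,
    2, 78, 54, 54, 2, 2, 2], [76, 2, 54, 34, 42, 42, 76, 54, 2, 42, 54, 76, 42, 2, 42, 54, 2, 42,
    76, 42, 54, 78, 54, 54, 54, 54, 42, 54, 78, 54, 76, 78, 42, 34, 42, 2, 54, 54, 1, 54, 42, 54,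
    42, 54, 54, 78, 42, 34, 55, 42, 54, 76, 54, 2, 42, 0, 78, 42, 42, 54, 76, 42, 0, 78, 54]⟩,
  ⟨[14, 5, 3, 17, 40, 80, 32], [(2, 4), (1, 10), (1, 12), (17, 8), (40, 16), (80, 32)], [80, 40,
    32, 17, 16, 14, 12, 10, 8, 5, 3, 1], [], []⟩,
  ⟨[14, 5, 3, 17, 104, 80, 48], [(2, 4), (1, 10), (1, 12), (17, 8), (40, 16), (72, 16), (32, 64)],
    [], [], []⟩,
  ⟨[22, 13, 3, 50, 73, 72, 48], [(2, 12), (1, 20), (9, 18), (50, 8), (73, 16), (72, 48)], [73, 72,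
    50, 48, 22, 18, 16, 13, 9, 8, 3], [], []⟩,
  ⟨[14, 49, 9, 5, 66, 130, 16, 32], [(1, 6), (1, 10), (4, 8), (49, 2), (66, 16), (130, 32)], [130,
    66, 49, 32, 16, 14, 10, 9, 6, 5, 2, 1], [], []⟩,
  ⟨[26, 69, 162, 17, 9, 68, 34, 4], [(1, 10), (1, 18), (8, 16), (69, 2), (34, 68), (162, 4)], [162,
    69, 68, 34, 26, 18, 17, 10, 9, 4, 2, 1], [], []⟩,
  ⟨[78, 49, 9, 5, 130, 66, 33, 16], [(4, 8), (49, 2), (1, 70), (1, 74), (33, 66), (130, 16)], [130,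
    78, 74, 70, 66, 49, 33, 16, 9, 5, 2, 1], [], []⟩,
  ⟨[58, 133, 74, 5, 33, 17, 4, 2], [(5, 10), (1, 26), (1, 42), (16, 32), (74, 4), (133, 2)], [133,
    74, 58, 42, 33, 26, 17, 10, 5, 4, 2, 1], [], []⟩,
  ⟨[14, 21, 3, 49, 138, 72, 32, 16], [(1, 12), (2, 20), (17, 10), (49, 8), (72, 32), (138, 16)],
    [138, 72, 49, 32, 21, 17, 16, 14, 10, 8, 3], [], []⟩,
  ⟨[46, 5, 3, 17, 72, 129, 16, 32], [(2, 4), (17, 8), (1, 42), (1, 44), (72, 16), (129, 32)], [129,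
    72, 46, 44, 42, 32, 17, 16, 8, 5, 3, 1], [], []⟩,
  ⟨[14, 5, 3, 17, 40, 16], [(2, 4), (1, 10), (1, 12), (17, 8), (40, 16)], [40, 17, 16, 14, 12, 10,
    8, 5, 3, 1], [88, 64, 52, 9, 52, 9, 86, 11, 88, 79, 64, 12, 64, 12, 11, 7, 88, 64, 52, 6, 52,
    6, 86, 88, 64, 64, 12, 64, 12, 47, 8, 88, 64, 52, 9, 52, 9, 86, 11, 88, 79, 64, 12, 64, 12, 88,
    52, 52, 86, 88, 64, 12, 12], [11, 8, 4, 64, 9, 9, 11, 64, 64, 8, 4, 86, 11, 64, 12, 12, 2, 52,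
    52, 86, 2, 7, 64, 6, 6, 4, 64, 64, 47, 8, 88, 52, 52, 64, 52, 52, 65, 64, 86, 44, 9, 52, 64,
    12, 1, 86, 9, 64, 52, 12, 1, 11, 64, 64, 3, 5, 88, 52, 52, 64, 88, 52, 64, 86, 0]⟩,
  ⟨[54, 73, 137, 6, 33, 17, 2, 4], [(9, 6), (1, 22), (1, 38), (16, 32), (73, 2), (137, 4)], [137,
    73, 54, 38, 33, 22, 17, 9, 6, 4, 2, 1], [], []⟩,
  ⟨[94, 161, 9, 5, 33, 18, 129, 66], [(4, 8), (33, 18), (1, 86), (1, 90), (161, 2), (129, 66)],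
    [161, 129, 94, 90, 86, 66, 33, 18, 9, 5, 2, 1], [], []⟩,
  ⟨[62, 5, 3, 65, 129, 257, 8, 16, 32], [(2, 4), (1, 58), (1, 60), (65, 8), (129, 16), (257, 32)],
    [257, 129, 65, 62, 60, 58, 32, 16, 8, 5, 3, 1], [], []⟩,
  ⟨[94, 161, 9, 5, 257, 66, 33, 2, 16], [(4, 8), (1, 86), (1, 90), (33, 66), (161, 2), (257, 16)],
    [257, 161, 94, 90, 86, 66, 33, 16, 9, 5, 2, 1], [], []⟩,
  ⟨[54, 13, 3, 306, 73, 137, 16, 32, 8], [(2, 12), (1, 52), (9, 50), (73, 16), (137, 32),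
    (306, 8)], [306, 137, 73, 54, 50, 32, 16, 13, 9, 8, 3], [], []⟩,
  ⟨[30, 5, 3, 33, 65, 8, 16], [(2, 4), (1, 26), (1, 28), (33, 8), (65, 16)], [65, 33, 30, 28, 26,
    16, 8, 5, 3, 1], [94, 70, 58, 15, 58, 15, 92, 5, 94, 85, 58, 18, 58, 18, 92, 5, 94, 85, 58, 18,
    58, 18, 92, 5, 94, 85, 70, 18, 70, 18, 3, 5, 94, 70, 58, 15, 58, 15, 92, 5, 94, 70, 58, 18, 58,
    18, 92, 17, 94, 85, 58, 18, 58, 18, 92, 5, 94, 85, 70, 18, 70, 18, 5, 94, 70, 58, 15, 58, 15,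
    92, 5, 94, 85, 58, 18, 58, 18, 92, 5, 94, 70, 58, 18, 58, 18, 92, 17, 94, 85, 70, 18, 70, 18,
    5, 94, 58, 58, 92, 4, 94, 71, 58, 18, 58, 18, 92, 94, 71, 58, 18, 58, 18, 92, 94, 70, 18, 18],
    [92, 92, 71, 18, 18, 1, 4, 58, 58, 92, 1, 92, 71, 18, 18, 4, 1, 58, 58, 92, 1, 94, 58, 58, 70,
    70, 58, 58, 71, 70, 92, 50, 15, 15, 58, 70, 18, 0, 92, 15, 15, 70, 58, 18, 0, 17, 5, 70, 70, 1,
    5, 17, 70, 70, 1, 5, 94, 58, 58, 70, 94, 58, 70, 92, 2]⟩,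
  ⟨[230, 281, 25, 38, 6, 9, 129, 65, 2], [(25, 6), (9, 38), (1, 102), (1, 166), (64, 128),
    (281, 2)], [281, 230, 166, 129, 102, 65, 38, 25, 9, 6, 2, 1], [], []⟩,
  ⟨[58, 197, 282, 37, 69, 9, 18, 2, 4], [(5, 26), (36, 8), (1, 50), (69, 18), (197, 2), (282, 4)],
    [282, 197, 69, 58, 37, 26, 18, 9, 5, 4, 2], [], []⟩,
  ⟨[46, 81, 9, 5, 34, 17, 2], [(4, 8), (1, 38), (1, 42), (17, 34), (81, 2)], [81, 46, 42, 38, 34,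
    17, 9, 5, 2, 1], [97, 73, 97, 88, 73, 18, 73, 21, 73, 18, 61, 21, 95, 20, 95, 8, 97, 21, 97,
    88, 21, 18, 61, 21, 21, 18, 61, 21, 95, 20, 95, 56, 97, 88, 97, 88, 73, 21, 73, 21, 61, 21, 73,
    21, 95, 20, 8, 97, 21, 97, 88, 21, 21, 73, 21, 21, 21, 73, 21, 95, 20, 6, 8, 97, 21, 97, 88,
    21, 18, 73, 21, 21, 18, 61, 21, 95, 20, 95, 8, 97, 97, 73, 21, 61, 21, 21, 61, 21, 95, 95, 2,
    21, 88, 97, 88, 21, 21, 73, 21, 21, 21, 73, 21, 95, 20, 8, 97, 74, 97, 73, 21, 21, 21, 21, 21,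
    21, 95], [95, 73, 21, 21, 6, 95, 61, 61, 1, 95, 1, 97, 21, 21, 21, 74, 61, 61, 21, 74, 73, 74,
    53, 18, 21, 61, 73, 18, 21, 0, 74, 18, 21, 73, 61, 18, 21, 0, 20, 1, 73, 73, 20, 1, 8, 95, 61,
    61, 1, 95, 2, 97, 61, 73, 61, 73, 97, 73, 61, 73, 20, 6, 8, 95, 2]⟩,
  ⟨[14, 21, 3, 49, 74, 8, 16], [(1, 12), (2, 20), (17, 10), (49, 8), (74, 16)], [74, 49, 21, 17,
    16, 14, 10, 8, 3], [98, 62, 62, 19, 62, 19, 96, 19, 98, 89, 74, 22, 74, 22, 19, 9, 98, 74, 74,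
    54, 62, 19, 96, 16, 98, 89, 74, 22, 74, 22, 22, 9, 98, 62, 62, 19, 62, 96, 96, 19, 98, 74, 74,
    22, 74, 22, 3, 21, 98, 74, 74, 54, 62, 96, 16, 98, 74, 74, 22, 74, 22, 22, 9, 98, 62, 62, 19,
    62, 19, 96, 19, 98, 89, 74, 22, 74, 22, 9, 98, 74, 74, 54, 62, 19, 96, 21, 98, 89, 74, 22, 74,
    22, 22, 9, 98, 62, 62, 22, 62, 96, 96, 19, 98, 74, 22, 62, 22, 98, 74, 54, 62, 96, 98, 74, 74,
    22, 22, 22], [96, 22, 74, 22, 0, 62, 96, 19, 62, 0, 96, 62, 96, 19, 74, 22, 0, 62, 0, 98, 62,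
    74, 54, 74, 74, 62, 74, 96, 3, 75, 22, 0, 62, 3, 21, 74, 0, 9, 74, 9, 98, 62, 74, 62, 74, 96,
    19, 62, 3, 21, 74, 9, 98, 74]⟩,
  ⟨[14, 5, 3, 17, 8], [(2, 4), (1, 10), (1, 12), (17, 8)], [17, 14, 12, 10, 8, 5, 3, 1], [99, 75,
    63, 20, 63, 20, 97, 22, 99, 90, 75, 23, 75, 23, 10, 99, 63, 63, 97, 99, 75, 23, 23], [97, 75,
    23, 23, 1, 63, 63, 97, 1, 99, 63, 63, 75, 63, 63, 76, 75, 97, 55, 20, 63, 75, 23, 0, 97, 20,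
    75, 63, 23, 0, 22, 75, 75, 1, 10, 99, 63, 63, 75, 99, 63, 75, 97, 4]⟩]

/-- The test succeeds on the whole list, by evaluation. -/
theorem checkList_derivedPatterns : checkList [] (derivedPatterns ++ [triangle]) = true := by
  decide +kernel

end Pattern

variable {V : Type*} {G : SimpleGraph V}

theorem Pattern.realizes_triangle {u v w : V} (huv : G.Adj u v) (huw : G.Adj u w)
    (hvw : G.Adj v w) : ∃ f, Pattern.Realizes G Pattern.triangle.rows f := by
  refine ⟨fun i => if i = 0 then u else if i = 1 then v else w, fun i hi j hj => ?_,
    fun i hi j hj => ?_⟩ <;>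
  · have hi : i < 3 := hi
    interval_cases i <;> interval_cases j <;>
      simp [Pattern.triangle, huv.ne', huw.ne', hvw.ne', huv.symm, huw.symm, hvw.symm] <;> decide

theorem Counterexample.not_adj [Fintype V] (hG : Counterexample G) (u v w : V)
    (huv : G.Adj u v) (huw : G.Adj u w) : ¬ G.Adj v w := by
  intro hvw
  obtain ⟨f, hf⟩ := Pattern.realizes_triangle huv huw hvw
  exact Pattern.not_realizes_of_checkList hG (fun q hq => absurd hq (List.not_mem_nil))
    Pattern.checkList_derivedPatterns _ (List.mem_append_right _ (List.mem_singleton_self _)) f hf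

end SimpleGraph

theorem mainTheorem2 {V : Type*} [Fintype V] (G : SimpleGraph V) (hconn : G.Connected)
    (htwin : G.FalseTwinFree) (hcard : 13 ≤ Fintype.card V) :
    7 ≤ {B : Set V | G.IsBiclique B}.ncard := by
  by_contra hlt
  have hG : G.Counterexample := ⟨hconn, htwin, hcard, by omega⟩
  have := SimpleGraph.card_le_two_mul_ncard_isBiclique htwin hG.exists_adj hG.not_adj
  have := hG.few
  omega
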